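/- Let $A\in\mathbb{Q}^{n\times n}$ be expanding (all complex eigenvalues have modulus $>1$), put $B=A^{-1}$, and let $\mathbb{Z}^n[M]=\sum_{k\ge 0}M^k\mathbb{Z}^n$ for $M\in\{A,B\}$, $\mathbb{Z}^n(A)=\sum_{k\in\mathbb{Z}}A^k\mathbb{Z}^n$, $a=|\mathbb{Z}^n[A]/A\mathbb{Z}^n[A]|$ and $b=|\mathbb{Z}^n[B]/B\mathbb{Z}^n[B]|$. For $y\in\mathbb{Z}^n(A)$ let $\nu(y)$ be the integer $k$ with $y\in B^k\mathbb{Z}^n[B]\setminus B^{k+1}\mathbb{Z}^n[B]$, and $\nu(y)=\infty$ if there is no such $k$. Let $\mathbb{Z}^n((B))$ be the (Hausdorff) completion of $\mathbb{Z}^n(A)$ with respect to $\mathbf{d}_B(y,y')=b^{-\nu(y-y')}$, where $b^{-\infty}=0$, and let $\mathbb{Z}^n[[B]]$ be its closed unit ball around $0$. Let $\mathbb{K}_A=\mathbb{R}^n\times\mathbb{Z}^n((B))$ with the maximum of the Euclidean metric and $\mathbf{d}_B$, on which $A$ acts by multiplication in both factors; let $\varphi:\mathbb{Z}^n(A)\to\mathbb{K}_A$,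 $x\mapsto(x,x)$; and let $\mu$ be the Haar measure on $\mathbb{K}_A$ that is the product of Lebesgue measure and the Haar measure on $\mathbb{Z}^n((B))$ giving $\mathbb{Z}^n[[B]]$ measure $1$. Let $\mathcal{D}\subset\mathbb{Z}^n[A]$ with $|\mathcal{D}|=a$, so that $(A,\mathcal{D})$ is a digit system. For $k\ge 1$ let $\mathcal{D}_k=\{d_0+Ad_1+\dots+A^{k-1}d_{k-1} : d_0,\dots,d_{k-1}\in\mathcal{D}\}$, and let $\mathcal{D}_\infty=\bigcup_{k\ge 1}\mathcal{D}_k$. Then there is a unique nonempty compact set $\mathcal{F}\subset\mathbb{K}_A$ with $A\mathcal{F}=\bigcup_{d\in\mathcal{D}}(\mathcal{F}+\varphi(d))$, and $\mu(\mathcal{F})>0$ if and only if both of the following hold: 1. for every $k\ge 1$, the $a^k$ expansions $d_0+Ad_1+\dots+A^{k-1}d_{k-1}$ with digits in $\mathcal{D}$ are pairwise distinct; 2. $\varphi(\mathcal{D}_\infty)$ is uniformly discrete in $\mathbb{K}_A$, that is, there is $r>0$ such that every open ball of radius $r$ in $\mathbb{K}_A$ contains at most one point of $\varphi(\mathcal{D}_\infty)$.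 -/

import Mathlib

open MeasureTheory

noncomputable section

namespace RationalTile

variable {n : ℕ}

/-- A rational matrix is expanding if all its complex eigenvalues have modulus greater than `1`. -/
def IsExpanding (A : Matrix (Fin n) (Fin n) ℚ) : Prop :=
  ∀ z ∈ spectrum ℂ (A.map (algebraMap ℚ ℂ)), 1 < ‖z‖

/-- Multiplication by a matrix, as an additive endomorphism of `ℚⁿ`. -/
def act (M : Matrix (Fin n) (Fin n) ℚ) : (Fin n → ℚ) →+ (Fin n → ℚ) :=
  M.mulVecLin.toAddMonoidHom

/-- The lattice `ℤⁿ` inside `ℚⁿ`. -/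
def intLattice (n : ℕ) : AddSubgroup (Fin n → ℚ) where
  carrier := {v | ∀ i, ∃ m : ℤ, v i = m}
  zero_mem' := fun _ => ⟨0, by simp⟩
  add_mem' := fun {v w} hv hw i => by
    obtain ⟨p, hp⟩ := hv i
    obtain ⟨q, hq⟩ := hw i
    exact ⟨p + q, by simp [hp, hq]⟩
  neg_mem' := fun {v} hv i => by
    obtain ⟨p, hp⟩ := hv i
    exact ⟨-p, by simp [hp]⟩

/-- `ℤⁿ[M]`, the sum of the groups `M ^ k ℤⁿ` over all `k ≥ 0`. -/
def polyLattice (M : Matrix (Fin n) (Fin n) ℚ) : AddSubgroup (Fin n → ℚ) :=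
  ⨆ k : ℕ, (intLattice n).map (act (M ^ k))

/-- `ℤⁿ(M)`, the sum of the groups `M ^ k ℤⁿ` over all integers `k` (for invertible `M`). -/
def laurentLattice (M : Matrix (Fin n) (Fin n) ℚ) : AddSubgroup (Fin n → ℚ) :=
  ⨆ k : ℤ, (intLattice n).map (act (M ^ k))

/-- `M ^ k ℤⁿ[M]` for an integer `k` (and invertible `M`). -/
def filt (M : Matrix (Fin n) (Fin n) ℚ) (k : ℤ) : AddSubgroup (Fin n → ℚ) :=
  (polyLattice M).map (act (M ^ k))

theorem act_mul (M N : Matrix (Fin n) (Fin n) ℚ) : act (M * N) = (act M).comp (act N) := by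
  refine DFunLike.ext _ _ fun v => ?_
  simp [act]

theorem act_one : act (1 : Matrix (Fin n) (Fin n) ℚ) = AddMonoidHom.id _ := by
  refine DFunLike.ext _ _ fun v => ?_
  simp [act]

theorem act_map_polyLattice_le (M : Matrix (Fin n) (Fin n) ℚ) :
    (polyLattice M).map (act M) ≤ polyLattice M := by
  unfold polyLattice
  rw [AddSubgroup.map_iSup]
  refine iSup_le fun k => ?_
  rw [AddSubgroup.map_map, ← act_mul, ← pow_succ']
  exact le_iSup (fun k : ℕ => (intLattice n).map (act (M ^ k))) (k + 1)

theorem act_map_laurentLattice_le {M : Matrix (Fin n) (Fin n) ℚ} (hM : IsUnit M.det) :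
    (laurentLattice M).map (act M) ≤ laurentLattice M := by
  unfold laurentLattice
  rw [AddSubgroup.map_iSup]
  refine iSup_le fun k => ?_
  rw [AddSubgroup.map_map, ← act_mul, ← Matrix.zpow_one_add hM]
  exact le_iSup (fun k : ℤ => (intLattice n).map (act (M ^ k))) (1 + k)

theorem polyLattice_le_laurentLattice (M : Matrix (Fin n) (Fin n) ℚ) :
    polyLattice M ≤ laurentLattice M := by
  refine iSup_le fun k => ?_
  have h := le_iSup (fun k : ℤ => (intLattice n).map (act (M ^ k))) (k : ℤ)
  rwa [zpow_natCast] at h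

theorem IsExpanding.isUnit_det {A : Matrix (Fin n) (Fin n) ℚ} (hA : IsExpanding A) :
    IsUnit A.det := by
  rw [isUnit_iff_ne_zero]
  intro h
  have h0 : (0 : ℂ) ∈ spectrum ℂ (A.map (algebraMap ℚ ℂ)) := by
    rw [spectrum.zero_mem_iff, Matrix.isUnit_iff_isUnit_det]
    have : (A.map (algebraMap ℚ ℂ)).det = algebraMap ℚ ℂ A.det := by
      rw [RingHom.map_det]; rfl
    simp [this, h]
  have := hA 0 h0
  simp at this
  linarith

/-- Multiplication by `M` on `ℤⁿ[M]`. -/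
def mulPoly (M : Matrix (Fin n) (Fin n) ℚ) : polyLattice M →+ polyLattice M :=
  ((act M).comp (polyLattice M).subtype).codRestrict (polyLattice M)
    fun x => act_map_polyLattice_le M ⟨x, x.2, rfl⟩

/-- The order `|ℤⁿ[M] / M ℤⁿ[M]|`. -/
def residueCard (M : Matrix (Fin n) (Fin n) ℚ) : ℕ :=
  Nat.card (polyLattice M ⧸ (mulPoly M).range)

/-! ### The `B`-adic valuation on `ℤⁿ(A) = ℤⁿ(B)`, where `B = A⁻¹` -/

/-- `ℤⁿ(A)` (which equals `ℤⁿ(B)`), as a type of its own, without the topology of `ℚⁿ`. -/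
def Laurent {A : Matrix (Fin n) (Fin n) ℚ} (_hA : IsExpanding A) : Type :=
  laurentLattice A

instance {A : Matrix (Fin n) (Fin n) ℚ} (hA : IsExpanding A) : AddCommGroup (Laurent hA) :=
  inferInstanceAs (AddCommGroup (laurentLattice A))

/-- The underlying vector of an element of `ℤⁿ(A)`. -/
def Laurent.vec {A : Matrix (Fin n) (Fin n) ℚ} (hA : IsExpanding A) :
    Laurent hA →+ (Fin n → ℚ) :=
  (laurentLattice A).subtype

open Classical in
/-- The `B`-adic valuation: the `k` with `y ∈ B ^ k ℤⁿ[B] \ B ^ (k + 1) ℤⁿ[B]` (there is at most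
one), and `∞` if there is none, that is, if `y` lies in `B ^ k ℤⁿ[B]` for every `k`. -/
def nu {A : Matrix (Fin n) (Fin n) ℚ} (hA : IsExpanding A) (y : Laurent hA) : WithTop ℤ :=
  if h : ∃ k : ℤ, Laurent.vec hA y ∈ filt A⁻¹ k ∧ Laurent.vec hA y ∉ filt A⁻¹ (k + 1)
  then (h.choose : WithTop ℤ) else ⊤

/-- `b ^ (-v)`, with the convention `b ^ (-∞) = 0`. -/
def negPow (b : ℕ) : WithTop ℤ → ℝ
  | ⊤ => 0
  | (k : ℤ) => (b : ℝ) ^ (-k)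

theorem filt_antitone {M : Matrix (Fin n) (Fin n) ℚ} (hM : IsUnit M.det) :
    Antitone (filt M) := by
  refine antitone_int_of_succ_le fun k => ?_
  unfold filt
  rw [Matrix.zpow_add_one hM, act_mul, ← AddSubgroup.map_map]
  exact AddSubgroup.map_mono (act_map_polyLattice_le M)

theorem map_filt {M : Matrix (Fin n) (Fin n) ℚ} (hM : IsUnit M.det) (j k : ℤ) :
    (filt M k).map (act (M ^ j)) = filt M (j + k) := by
  unfold filt
  rw [AddSubgroup.map_map, ← act_mul, ← Matrix.zpow_add hM]

theorem filt_zero (M : Matrix (Fin n) (Fin n) ℚ) : filt M 0 = polyLattice M := by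
  simp [filt, act_one]

theorem act_zpow_injective {M : Matrix (Fin n) (Fin n) ℚ} (hM : IsUnit M.det) (j : ℤ) :
    Function.Injective (act (M ^ j)) := by
  have h : (act (M ^ (-j))).comp (act (M ^ j)) = AddMonoidHom.id _ := by
    rw [← act_mul, ← Matrix.zpow_add hM, neg_add_cancel, zpow_zero, act_one]
  intro x y hxy
  have hx := DFunLike.congr_fun h x
  have hy := DFunLike.congr_fun h y
  simp only [AddMonoidHom.comp_apply, AddMonoidHom.id_apply] at hx hy
  rw [← hx, ← hy, hxy]

theorem exists_mem_filt {A : Matrix (Fin n) (Fin n) ℚ} (hA : IsExpanding A) (y : Laurent hA) :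
    ∃ k : ℤ, Laurent.vec hA y ∈ filt A⁻¹ k := by
  have hB : IsUnit (A⁻¹).det := by simpa using hA.isUnit_det
  have hle : laurentLattice A ≤ ⨆ k : ℤ, filt A⁻¹ k := by
    refine iSup_le fun k => le_trans ?_ (le_iSup (filt A⁻¹) (-k))
    unfold filt
    rw [Matrix.inv_zpow' hA.isUnit_det, neg_neg]
    refine AddSubgroup.map_mono ?_
    have h := le_iSup (fun k : ℕ => (intLattice n).map (act (A⁻¹ ^ k))) 0
    have e : act (A⁻¹ ^ 0) = AddMonoidHom.id _ := by rw [pow_zero, act_one]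
    rwa [e, AddSubgroup.map_id] at h
  have hy : Laurent.vec hA y ∈ ⨆ k : ℤ, filt A⁻¹ k := hle (Subtype.prop (p := (· ∈ laurentLattice A)) y)
  rwa [AddSubgroup.mem_iSup_of_directed (filt_antitone hB).directed_le] at hy

theorem exists_int_matrix (A : Matrix (Fin n) (Fin n) ℚ) :
    ∃ m : ℕ, m ≠ 0 ∧ ∀ v ∈ intLattice n, m • act A v ∈ intLattice n := by
  refine ⟨∏ i, ∏ j, (A i j).den, ?_, ?_⟩
  · exact Finset.prod_ne_zero_iff.2 fun i _ => Finset.prod_ne_zero_iff.2 fun j _ => (A i j).den_nz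
  · intro v hv i
    choose z hz using hv
    have key : ∀ j, ∃ q : ℤ, ((∏ i, ∏ j, (A i j).den : ℕ) : ℚ) * A i j = q := by
      intro j
      have hd : (A i j).den ∣ ∏ i, ∏ j, (A i j).den :=
        (Finset.dvd_prod_of_mem (fun j => (A i j).den) (Finset.mem_univ j)).trans
          (Finset.dvd_prod_of_mem (fun i => ∏ j, (A i j).den) (Finset.mem_univ i))
      obtain ⟨c, hc⟩ := hd
      refine ⟨c * (A i j).num, ?_⟩
      rw [hc]
      push_cast
      have := Rat.den_mul_eq_num (A i j)
      rw [mul_comm ((A i j).den : ℚ), mul_assoc, this]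
    choose q hq using key
    refine ⟨∑ j, q j * z j, ?_⟩
    simp only [act, Pi.smul_apply, nsmul_eq_mul, LinearMap.toAddMonoidHom_coe,
      Matrix.mulVecLin_apply, Matrix.mulVec, dotProduct, Finset.mul_sum]
    push_cast
    refine Finset.sum_congr rfl fun j _ => ?_
    rw [← mul_assoc, ← hz j, ← hq j]
    push_cast
    ring

theorem intLattice_le_polyLattice (M : Matrix (Fin n) (Fin n) ℚ) :
    intLattice n ≤ polyLattice M := by
  have h := le_iSup (fun k : ℕ => (intLattice n).map (act (M ^ k))) 0
  have e : act (M ^ 0) = AddMonoidHom.id _ := by rw [pow_zero, act_one]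
  rwa [e, AddSubgroup.map_id] at h

theorem polyLattice_le_sup (M : Matrix (Fin n) (Fin n) ℚ) :
    polyLattice M ≤ intLattice n ⊔ (polyLattice M).map (act M) := by
  refine iSup_le fun k => ?_
  cases k with
  | zero =>
    have e : act (M ^ 0) = AddMonoidHom.id _ := by rw [pow_zero, act_one]
    rw [e, AddSubgroup.map_id]
    exact le_sup_left
  | succ k =>
    refine le_trans ?_ le_sup_right
    rw [pow_succ', act_mul, ← AddSubgroup.map_map]
    exact AddSubgroup.map_mono (le_iSup (fun k : ℕ => (intLattice n).map (act (M ^ k))) k)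

theorem finite_residue {M : Matrix (Fin n) (Fin n) ℚ} (hM : IsUnit M.det) :
    Finite (polyLattice M ⧸ (mulPoly M).range) := by
  let c : (Fin n → ℤ) →+ (Fin n → ℚ) :=
    { toFun := fun z i => z i
      map_zero' := by ext; simp
      map_add' := fun x y => by ext; simp }
  have hc : ∀ z, c z ∈ intLattice n := fun z i => ⟨z i, rfl⟩
  let f : (Fin n → ℤ) →+ polyLattice M ⧸ (mulPoly M).range :=
    (QuotientAddGroup.mk' _).comp
      (c.codRestrict (polyLattice M) fun z => intLattice_le_polyLattice M (hc z))
  have hf : Function.Surjective f := by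
    intro q
    obtain ⟨⟨x, hx⟩, rfl⟩ := QuotientAddGroup.mk_surjective q
    obtain ⟨u, hu, w, ⟨p, hp, rfl⟩, hs⟩ := AddSubgroup.mem_sup.1 (polyLattice_le_sup M hx)
    choose z hz using hu
    refine ⟨z, ?_⟩
    refine QuotientAddGroup.eq.2 ⟨⟨p, hp⟩, ?_⟩
    apply Subtype.ext
    change act M p = -(c z) + x
    have : c z = u := funext fun i => (hz i).symm
    rw [this, ← hs]
    abel
  have hfg : AddGroup.FG (polyLattice M ⧸ (mulPoly M).range) := AddGroup.fg_of_surjective hf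
  obtain ⟨m, hm, hmA⟩ := exists_int_matrix M⁻¹
  refine AddCommGroup.finite_of_fg_isAddTorsion _ fun q => ?_
  obtain ⟨z, rfl⟩ := hf q
  refine isOfFinAddOrder_iff_nsmul_eq_zero.2 ⟨m, Nat.pos_of_ne_zero hm, ?_⟩
  rw [← map_nsmul]
  refine (QuotientAddGroup.eq_zero_iff _).2
    ⟨⟨_, intLattice_le_polyLattice M (hmA _ (hc z))⟩, Subtype.ext ?_⟩
  change act M (m • act M⁻¹ (c z)) = c (m • z)
  rw [map_nsmul, map_nsmul]
  have e : (act M).comp (act M⁻¹) = AddMonoidHom.id _ := by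
    rw [← act_mul, Matrix.mul_nonsing_inv _ hM, act_one]
  exact congrArg (m • ·) (DFunLike.congr_fun e (c z))

theorem residueCard_pos {M : Matrix (Fin n) (Fin n) ℚ} (hM : IsUnit M.det) :
    0 < residueCard M := by
  have := finite_residue hM
  exact Nat.card_pos

section Valuation

variable {A : Matrix (Fin n) (Fin n) ℚ} (hA : IsExpanding A)

theorem isUnit_det_inv {A : Matrix (Fin n) (Fin n) ℚ} (hA : IsExpanding A) :
    IsUnit (A⁻¹).det := by simpa using hA.isUnit_det

theorem nu_eq {y : Laurent hA} {k : ℤ} (h : Laurent.vec hA y ∈ filt A⁻¹ k)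
    (h' : Laurent.vec hA y ∉ filt A⁻¹ (k + 1)) : nu hA y = k := by
  have hex : ∃ k : ℤ, Laurent.vec hA y ∈ filt A⁻¹ k ∧ Laurent.vec hA y ∉ filt A⁻¹ (k + 1) :=
    ⟨k, h, h'⟩
  have hs := hex.choose_spec
  have hv : nu hA y = (hex.choose : WithTop ℤ) := by
    unfold nu
    rw [dif_pos hex]
  rw [hv]
  have hanti := filt_antitone (isUnit_det_inv hA)
  refine congrArg _ (le_antisymm ?_ ?_)
  · by_contra hlt
    exact h' (hanti (by lia) hs.1)
  · by_contra hlt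
    exact hs.2 (hanti (by lia) h)

theorem nu_eq_top {y : Laurent hA} (h : ∀ k, Laurent.vec hA y ∈ filt A⁻¹ k) :
    nu hA y = ⊤ := by
  unfold nu
  rw [dif_neg]
  rintro ⟨k, -, hk⟩
  exact hk (h _)

theorem nu_cases (y : Laurent hA) :
    (∀ k, Laurent.vec hA y ∈ filt A⁻¹ k) ∨
      ∃ k : ℤ, Laurent.vec hA y ∈ filt A⁻¹ k ∧ Laurent.vec hA y ∉ filt A⁻¹ (k + 1) := by
  by_cases h : ∃ k : ℤ, Laurent.vec hA y ∈ filt A⁻¹ k ∧ Laurent.vec hA y ∉ filt A⁻¹ (k + 1)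
  · exact Or.inr h
  · left
    push Not at h
    obtain ⟨k₀, hk₀⟩ := exists_mem_filt hA y
    intro k
    rcases le_total k k₀ with hk | hk
    · exact filt_antitone (isUnit_det_inv hA) hk hk₀
    · exact Int.leInduction hk₀ (fun j _ hj => h j hj) k hk

/-- The absolute value `b ^ (-ν y)` on `ℤⁿ(A)`, where `b = |ℤⁿ[B] / B ℤⁿ[B]|`. -/
def badicAbs (y : Laurent hA) : ℝ := negPow (residueCard A⁻¹) (nu hA y)

theorem one_le_b {A : Matrix (Fin n) (Fin n) ℚ} (hA : IsExpanding A) :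
    (1 : ℝ) ≤ residueCard A⁻¹ := by
  exact_mod_cast residueCard_pos (isUnit_det_inv hA)

theorem badicAbs_le {y : Laurent hA} {k : ℤ} (h : Laurent.vec hA y ∈ filt A⁻¹ k) :
    badicAbs hA y ≤ (residueCard A⁻¹ : ℝ) ^ (-k) := by
  rcases nu_cases hA y with hy | ⟨j, hj, hj'⟩
  · rw [badicAbs, nu_eq_top hA hy]
    change (0 : ℝ) ≤ _
    positivity
  · rw [badicAbs, nu_eq hA hj hj']
    change (residueCard A⁻¹ : ℝ) ^ (-j) ≤ _
    refine zpow_le_zpow_right₀ (one_le_b hA) ?_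
    by_contra hlt
    exact hj' (filt_antitone (isUnit_det_inv hA) (by lia) h)

theorem le_badicAbs {y : Laurent hA} {k : ℤ} (h : Laurent.vec hA y ∉ filt A⁻¹ (k + 1)) :
    (residueCard A⁻¹ : ℝ) ^ (-k) ≤ badicAbs hA y := by
  rcases nu_cases hA y with hy | ⟨j, hj, hj'⟩
  · exact absurd (hy _) h
  · rw [badicAbs, nu_eq hA hj hj']
    change _ ≤ (residueCard A⁻¹ : ℝ) ^ (-j)
    refine zpow_le_zpow_right₀ (one_le_b hA) ?_
    by_contra hlt
    exact h (filt_antitone (isUnit_det_inv hA) (by lia) hj)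

theorem badicAbs_nonneg (y : Laurent hA) : 0 ≤ badicAbs hA y := by
  rcases nu_cases hA y with hy | ⟨j, hj, hj'⟩
  · rw [badicAbs, nu_eq_top hA hy]
    exact le_rfl
  · rw [badicAbs, nu_eq hA hj hj']
    change (0 : ℝ) ≤ (residueCard A⁻¹ : ℝ) ^ (-j)
    positivity

theorem badicAbs_add_le_max (x y : Laurent hA) :
    badicAbs hA (x + y) ≤ max (badicAbs hA x) (badicAbs hA y) := by
  rcases nu_cases hA (x + y) with h | ⟨k, hk, hk'⟩
  · have : badicAbs hA (x + y) = 0 := by rw [badicAbs, nu_eq_top hA h]; rfl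
    rw [this]
    exact le_max_of_le_left (badicAbs_nonneg hA x)
  · refine (badicAbs_le hA hk).trans ?_
    rw [map_add] at hk'
    by_cases hx : Laurent.vec hA x ∈ filt A⁻¹ (k + 1)
    · by_cases hy : Laurent.vec hA y ∈ filt A⁻¹ (k + 1)
      · exact absurd (add_mem hx hy) hk'
      · exact le_max_of_le_right (le_badicAbs hA hy)
    · exact le_max_of_le_left (le_badicAbs hA hx)

theorem nu_neg (y : Laurent hA) : nu hA (-y) = nu hA y := by
  have e : ∀ k, (Laurent.vec hA (-y) ∈ filt A⁻¹ k ↔ Laurent.vec hA y ∈ filt A⁻¹ k) := fun k => by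
    rw [map_neg, neg_mem_iff]
  rcases nu_cases hA y with h | ⟨k, hk, hk'⟩
  · rw [nu_eq_top hA h, nu_eq_top hA fun k => (e k).2 (h k)]
  · rw [nu_eq hA hk hk', nu_eq hA ((e _).2 hk) (mt (e _).1 hk')]

theorem badicAbs_zero : badicAbs hA 0 = 0 := by
  rw [badicAbs, nu_eq_top hA (fun k => by rw [map_zero]; exact zero_mem _)]
  rfl

/-- The metric `d_B(y, y') = b ^ (-ν (y - y'))` on `ℤⁿ(A)`. -/
instance : SeminormedAddCommGroup (Laurent hA) :=
  AddGroupSeminorm.toSeminormedAddCommGroup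
    { toFun := badicAbs hA
      map_zero' := badicAbs_zero hA
      add_le' := fun x y => (badicAbs_add_le_max hA x y).trans
        (max_le_add_of_nonneg (badicAbs_nonneg hA x) (badicAbs_nonneg hA y))
      neg' := fun y => by rw [badicAbs, badicAbs, nu_neg] }

theorem norm_eq_badicAbs (y : Laurent hA) : ‖y‖ = badicAbs hA y := rfl

theorem dist_eq_badicAbs (y y' : Laurent hA) : dist y y' = badicAbs hA (y - y') := by
  rw [dist_eq_norm, norm_eq_badicAbs]

/-- The space `ℤⁿ((B))` of `B`-adic series: the completion of `ℤⁿ(A)` for `d_B`. Points at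
distance `0` are identified in this completion. -/
abbrev BadicSeries : Type := UniformSpace.Completion (Laurent hA)

instance : MeasurableSpace (BadicSeries hA) := borel _

instance : BorelSpace (BadicSeries hA) := ⟨rfl⟩

/-- Multiplication by `A` on `ℤⁿ(A)`. -/
def mulLaurent : Laurent hA →+ Laurent hA :=
  ((act A).comp (laurentLattice A).subtype).codRestrict (laurentLattice A)
    fun x => act_map_laurentLattice_le hA.isUnit_det ⟨x, x.2, rfl⟩

theorem vec_mulLaurent_mem {y : Laurent hA} {k : ℤ} (h : Laurent.vec hA y ∈ filt A⁻¹ k) :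
    Laurent.vec hA (mulLaurent hA y) ∈ filt A⁻¹ (k - 1) := by
  have e : (A⁻¹ ^ (-1 : ℤ)) = A := by
    rw [Matrix.inv_zpow' hA.isUnit_det, neg_neg, zpow_one]
  have := map_filt (isUnit_det_inv hA) (-1) k
  rw [e, neg_add_eq_sub] at this
  rw [← this]
  exact ⟨_, h, rfl⟩

theorem norm_mulLaurent_le (y : Laurent hA) :
    ‖mulLaurent hA y‖ ≤ residueCard A⁻¹ * ‖y‖ := by
  have hb : (0 : ℝ) < residueCard A⁻¹ := lt_of_lt_of_le one_pos (one_le_b hA)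
  rw [norm_eq_badicAbs, norm_eq_badicAbs]
  rcases nu_cases hA y with hy | ⟨j, hj, hj'⟩
  · have : badicAbs hA (mulLaurent hA y) = 0 := by
      rw [badicAbs, nu_eq_top hA]
      · rfl
      · intro k
        simpa using vec_mulLaurent_mem hA (hy (k + 1))
    rw [this]
    exact mul_nonneg hb.le (badicAbs_nonneg hA y)
  · refine (badicAbs_le hA (vec_mulLaurent_mem hA hj)).trans ?_
    have h2 := le_badicAbs hA hj'
    calc (residueCard A⁻¹ : ℝ) ^ (-(j - 1)) = residueCard A⁻¹ * (residueCard A⁻¹ : ℝ) ^ (-j) := by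
          rw [← zpow_one_add₀ hb.ne']; congr 1; ring
      _ ≤ _ := mul_le_mul_of_nonneg_left h2 hb.le

theorem continuous_mulLaurent : Continuous (mulLaurent hA) :=
  AddMonoidHomClass.continuous_of_bound _ _ (norm_mulLaurent_le hA)

/-- Multiplication by `A` on `ℤⁿ((B))`, the continuous extension of the one on `ℤⁿ(A)`. -/
def mulBadic : BadicSeries hA →+ BadicSeries hA :=
  (mulLaurent hA).completion (continuous_mulLaurent hA)

/-! ### Compactness of `ℤⁿ[[B]]`, and the `B`-adic measure -/

theorem relIndex_succ {A : Matrix (Fin n) (Fin n) ℚ} (hA : IsExpanding A) (k : ℤ) :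
    (filt A⁻¹ (k + 1)).relIndex (filt A⁻¹ k) = residueCard A⁻¹ := by
  have hB := isUnit_det_inv hA
  have h1 := map_filt hB k 1
  have h0 := map_filt hB k 0
  rw [add_zero] at h0
  rw [← h1, ← h0, AddSubgroup.relIndex_map_map_of_injective _ _ (act_zpow_injective hB k),
    filt_zero]
  unfold residueCard
  rw [← AddSubgroup.index_eq_card, AddSubgroup.relIndex]
  congr 1
  ext x
  rw [AddSubgroup.mem_addSubgroupOf, AddMonoidHom.mem_range]
  unfold filt
  rw [zpow_one]
  constructor
  · rintro ⟨p, hp, hpx⟩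
    exact ⟨⟨p, hp⟩, Subtype.ext hpx⟩
  · rintro ⟨p, rfl⟩
    exact ⟨p.1, p.2, rfl⟩

theorem filt_le_succ {A : Matrix (Fin n) (Fin n) ℚ} (hA : IsExpanding A)
    (hb : residueCard A⁻¹ = 1) (k : ℤ) : filt A⁻¹ k ≤ filt A⁻¹ (k + 1) :=
  AddSubgroup.relIndex_eq_one.1 ((relIndex_succ hA k).trans hb)

theorem relIndex_nat {A : Matrix (Fin n) (Fin n) ℚ} (hA : IsExpanding A) (N : ℕ) :
    (filt A⁻¹ N).relIndex (filt A⁻¹ 0) ≠ 0 := by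
  induction N with
  | zero => simp
  | succ N ih =>
    have hanti := filt_antitone (isUnit_det_inv hA)
    rw [← AddSubgroup.relIndex_mul_relIndex (filt A⁻¹ ((N + 1 : ℕ) : ℤ)) (filt A⁻¹ N) (filt A⁻¹ 0)
      (hanti (by lia)) (hanti (by lia))]
    refine mul_ne_zero ?_ ih
    rw [Nat.cast_succ, relIndex_succ hA]
    exact (residueCard_pos (isUnit_det_inv hA)).ne'

theorem mem_filt_zero_of_norm_lt {y : Laurent hA} (hy : ‖y‖ < 2) :
    Laurent.vec hA y ∈ filt A⁻¹ 0 := by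
  by_contra h
  have h1 : (residueCard A⁻¹ : ℝ) ^ (-(-1 : ℤ)) ≤ ‖y‖ := le_badicAbs hA (k := -1) (by simpa using h)
  rw [neg_neg, zpow_one] at h1
  have h2 : residueCard A⁻¹ < 2 := by exact_mod_cast h1.trans_lt hy
  have hb : residueCard A⁻¹ = 1 := by
    have := residueCard_pos (isUnit_det_inv hA)
    lia
  rcases nu_cases hA y with hy' | ⟨k, hk, hk'⟩
  · exact h (hy' 0)
  · exact hk' (filt_le_succ hA hb k hk)

theorem exists_norm_lt_of_mem {ε : ℝ} (hε : 0 < ε) :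
    ∃ N : ℕ, ∀ y : Laurent hA, Laurent.vec hA y ∈ filt A⁻¹ N → ‖y‖ < ε := by
  by_cases hb : residueCard A⁻¹ = 1
  · refine ⟨0, fun y _ => ?_⟩
    rcases nu_cases hA y with hy' | ⟨k, hk, hk'⟩
    · rw [norm_eq_badicAbs, badicAbs, nu_eq_top hA hy']
      exact hε
    · exact absurd (filt_le_succ hA hb k hk) hk'
  · have h1 : (1 : ℝ) < residueCard A⁻¹ := by
      have := residueCard_pos (isUnit_det_inv hA)
      exact_mod_cast (by lia : 1 < residueCard A⁻¹)
    obtain ⟨N, hN⟩ := exists_pow_lt_of_lt_one hε (inv_lt_one_of_one_lt₀ h1)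
    refine ⟨N, fun y hy => (badicAbs_le hA hy).trans_lt ?_⟩
    rwa [zpow_neg, zpow_natCast, ← inv_pow]

theorem totallyBounded_ball : TotallyBounded (Metric.ball (0 : Laurent hA) 2) := by
  rw [Metric.totallyBounded_iff]
  intro ε hε
  obtain ⟨N, hN⟩ := exists_norm_lt_of_mem hA hε
  let G : ℤ → AddSubgroup (Laurent hA) := fun k => (filt A⁻¹ k).comap (Laurent.vec hA)
  have hfin : (G N).relIndex (G 0) ≠ 0 := by
    change ((filt A⁻¹ N).comap (Laurent.vec hA)).relIndex (G 0) ≠ 0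
    rw [AddSubgroup.relIndex_comap]
    exact mt (AddSubgroup.relIndex_eq_zero_of_le_right (AddSubgroup.map_comap_le _ _))
      (relIndex_nat hA N)
  have : ((G N).addSubgroupOf (G 0)).FiniteIndex := ⟨hfin⟩
  have : Finite (G 0 ⧸ (G N).addSubgroupOf (G 0)) :=
    AddSubgroup.finite_quotient_of_finiteIndex
  refine ⟨Set.range fun q : G 0 ⧸ (G N).addSubgroupOf (G 0) => (q.out : Laurent hA),
    Set.finite_range _, fun y hy => ?_⟩
  have hy0 : y ∈ G 0 := mem_filt_zero_of_norm_lt hA (by simpa using hy)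
  rw [Set.biUnion_range, Set.mem_iUnion]
  refine ⟨QuotientAddGroup.mk ⟨y, hy0⟩, ?_⟩
  rw [Metric.mem_ball, dist_eq_norm, ← neg_add_eq_sub]
  refine hN _ ?_
  have h := QuotientAddGroup.eq.1 (Quotient.out_eq
    (QuotientAddGroup.mk ⟨y, hy0⟩ : G 0 ⧸ (G N).addSubgroupOf (G 0)))
  exact h

theorem isCompact_unitBall : IsCompact (Metric.closedBall (0 : BadicSeries hA) 1) := by
  refine TotallyBounded.isCompact_of_isClosed ?_ Metric.isClosed_closedBall
  refine (((totallyBounded_ball hA).image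
    (UniformSpace.Completion.uniformContinuous_coe (Laurent hA))).closure).subset ?_
  intro y hy
  rw [mem_closedBall_zero_iff] at hy
  refine Metric.mem_closure_iff.2 fun ε hε => ?_
  obtain ⟨z, hz⟩ := (UniformSpace.Completion.denseRange_coe (α := Laurent hA)).exists_dist_lt y
    (lt_min hε one_pos)
  refine ⟨z, ⟨z, ?_, rfl⟩, hz.trans_le (min_le_left _ _)⟩
  rw [mem_ball_zero_iff, ← UniformSpace.Completion.norm_coe]
  have h1 := hz.trans_le (min_le_right _ _)
  rw [dist_eq_norm, norm_sub_rev] at h1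
  have h2 := norm_add_le ((z : BadicSeries hA) - y) y
  rw [sub_add_cancel] at h2
  linarith

/-- `ℤⁿ[[B]]`, the set of all `y` with `ν y ≥ 0`, that is, with `d_B(y, 0) ≤ 1`. -/
def badicIntegers : TopologicalSpace.PositiveCompacts (BadicSeries hA) where
  carrier := Metric.closedBall 0 1
  isCompact' := isCompact_unitBall hA
  interior_nonempty' :=
    ⟨0, Metric.ball_subset_interior_closedBall (Metric.mem_ball_self one_pos)⟩

/-- The `B`-adic measure: the Haar measure on `ℤⁿ((B))` that gives `ℤⁿ[[B]]` measure `1`. -/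
def badicMeasure : Measure (BadicSeries hA) :=
  Measure.addHaarMeasure (badicIntegers hA)

/-- The representation space `ℝⁿ × ℤⁿ((B))`, with the maximum of the Euclidean and the `B`-adic
metric. -/
abbrev RepSpace : Type := EuclideanSpace ℝ (Fin n) × BadicSeries hA

/-- The Haar measure on the representation space: Lebesgue measure times `B`-adic measure. -/
def repMeasure : Measure (RepSpace hA) :=
  (volume : Measure (EuclideanSpace ℝ (Fin n))).prod (badicMeasure hA)

/-- Multiplication by `A` on the representation space. -/
def mulRep (p : RepSpace hA) : RepSpace hA :=
  (WithLp.toLp 2 ((A.map (Rat.cast : ℚ → ℝ)).mulVec p.1.ofLp), mulBadic hA p.2)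

/-- The inclusion of `ℤⁿ[A]` into `ℤⁿ(A)`. -/
def inclLaurent (x : polyLattice A) : Laurent hA :=
  (⟨x.1, polyLattice_le_laurentLattice A x.2⟩ : laurentLattice A)

/-- The diagonal embedding `φ x = (x, x)` of `ℤⁿ(A)` into the representation space. -/
def diag (x : Laurent hA) : RepSpace hA :=
  (WithLp.toLp 2 fun i => ((Laurent.vec hA x i : ℚ) : ℝ), (x : BadicSeries hA))

/-- `F` is a self-affine set of `(A, D)`: a nonempty compact subset of the representation space
with `A F = ⋃_{d ∈ D} (F + φ(d))`. -/
def IsSelfAffineSet (D : Finset (polyLattice A)) (F : Set (RepSpace hA)) : Prop :=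
  F.Nonempty ∧ IsCompact F ∧
    mulRep hA '' F = ⋃ d ∈ D, (fun p => p + diag hA (inclLaurent hA d)) '' F

end Valuation

/-- `(A, D)` is a digit system: `A` is expanding and `D ⊆ ℤⁿ[A]` has `|ℤⁿ[A] / A ℤⁿ[A]|`
elements. -/
def IsDigitSystem (A : Matrix (Fin n) (Fin n) ℚ) (D : Finset (polyLattice A)) : Prop :=
  IsExpanding A ∧ D.card = residueCard A

/-- The expansion `d₀ + A d₁ + ⋯ + A ^ (k - 1) d_{k - 1}`. -/
def expansion {A : Matrix (Fin n) (Fin n) ℚ} {D : Finset (polyLattice A)} {k : ℕ}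
    (d : Fin k → D) : polyLattice A :=
  ∑ i : Fin k, (mulPoly A)^[i] (d i)

/-- The set `D_k` of all expansions of length `k`. -/
def digitBlocks {A : Matrix (Fin n) (Fin n) ℚ} (D : Finset (polyLattice A)) (k : ℕ) :
    Set (polyLattice A) :=
  Set.range fun d : Fin k → D => expansion d

/-- The set `D_∞`, the union of the `D_k` with `k ≥ 1`. -/
def digitBlocksInf {A : Matrix (Fin n) (Fin n) ℚ} (D : Finset (polyLattice A)) :
    Set (polyLattice A) :=
  ⋃ k ≥ 1, digitBlocks D k

/-- A set is uniformly discrete if, for some `r > 0`, every open ball of radius `r` contains at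
most one of its points. -/
def IsUniformlyDiscrete {X : Type*} [PseudoMetricSpace X] (M : Set X) : Prop :=
  ∃ r > 0, ∀ c : X, (Metric.ball c r ∩ M).Subsingleton

end RationalTile

end

/-!
The map `x ↦ A⁻¹ x` on `𝕂_A` has iterates tending to `0`: on `ℝⁿ` because `A⁻¹` has spectral
radius below `1`, and on `ℤⁿ((B))` because it shifts the filtration. Some iterate of the Hutchinson
operator `K ↦ ⋃ d ∈ D, A⁻¹ (K + φ d)` is therefore a contraction, which gives existence and
uniqueness of `F`.

The group `Γ = φ(ℤⁿ[A])` is a uniform lattice in `𝕂_A`. It is discrete because the elements of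
`ℤⁿ[A] ∩ ℤⁿ[A⁻¹]` have bounded denominators, and cocompact because `ℤⁿ(A) = ℤⁿ[A] + ℤⁿ[A⁻¹]`.
Comparing a weight whose `Γ`-translates sum to `1` with its image under `A` shows that `A`
multiplies `μ` by the index `a` of `A Γ` in `Γ`.

If `μ F > 0`, then `Aᵏ F` has measure `aᵏ μ F` and is the union of the translates of `F` by the
points of `φ(D_k)`, so there are `aᵏ` such points. Conversely, if there are `aᵏ` such points for
each `k`, then the balls of a fixed small radius around them are disjoint, and `A⁻ᵏ` maps these
balls into any prescribed neighbourhood of `F` once `k` is large. So each neighbourhood of `F` has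
measure at least that of one ball, and hence so does `F`.
-/

noncomputable section

namespace RationalTile

open Filter Topology Metric
open scoped NNReal ENNReal

section DigitSum

variable {M N ι : Type*} [AddCommMonoid M] [AddCommMonoid N] {f : M → M} {δ : ι → M} {k : ℕ}

/-- The value `δ(d₀) + f δ(d₁) + ⋯ + f ^ (k - 1) δ(d_{k - 1})` of a word `d` of length `k`, where
`δ` assigns to each digit an element of `M`. -/
def digitSum (f : M → M) (δ : ι → M) {k : ℕ} (d : Fin k → ι) : M :=
  ∑ i : Fin k, f^[i] (δ (d i))

theorem digitSum_zero (d : Fin 0 → ι) : digitSum f δ d = 0 := by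
  simp only [digitSum, Finset.univ_eq_empty, Finset.sum_empty]

theorem digitSum_succ {F : Type*} [FunLike F M M] [AddMonoidHomClass F M M] (f : F)
    (d : Fin (k + 1) → ι) : digitSum f δ d = δ (d 0) + f (digitSum f δ (Fin.tail d)) := by
  simp only [digitSum, Fin.sum_univ_succ, Fin.val_zero, Function.iterate_zero, id_eq,
    Fin.val_succ, Function.iterate_succ_apply', map_sum, Fin.tail]

theorem map_digitSum {φ : M →+ N} {g : N → N} (h : Function.Semiconj φ f g) (d : Fin k → ι) :
    φ (digitSum f δ d) = digitSum g (φ ∘ δ) d := by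
  simp only [digitSum, map_sum, (h.iterate_right _).eq, Function.comp_apply]

theorem digitSum_mem {F : Type*} [FunLike F M M] [AddMonoidHomClass F M M] {f : F}
    {Γ : AddSubmonoid M} (hf : ∀ x ∈ Γ, f x ∈ Γ) (hδ : ∀ i, δ i ∈ Γ)
    (d : Fin k → ι) : digitSum f δ d ∈ Γ := by
  induction k with
  | zero => exact digitSum_zero (f := f) (δ := δ) d ▸ Γ.zero_mem
  | succ k ih =>
    rw [digitSum_succ]
    exact Γ.add_mem (hδ _) (hf _ (ih _))

end DigitSum

section Contraction

variable {G H : Type*} [SeminormedAddCommGroup G] [SeminormedAddCommGroup H]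

/-- The iterates of `S` eventually shrink norms by every prescribed factor; for a linear map this
says that `S ^ k` tends to `0`. Unlike a Lipschitz constant below `1`, the condition depends on
the norm only up to equivalence. -/
def IsEventuallyContracting (S : G → G) : Prop :=
  ∀ ε > 0, ∀ᶠ k in atTop, ∀ x, ‖S^[k] x‖ ≤ ε * ‖x‖

theorem isEventuallyContracting_of_norm_le {S : G → G} {c : ℝ} (hc0 : 0 ≤ c) (hc1 : c < 1)
    (hS : ∀ x, ‖S x‖ ≤ c * ‖x‖) : IsEventuallyContracting S := by
  have hiter : ∀ k x, ‖S^[k] x‖ ≤ c ^ k * ‖x‖ := fun k x => by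
    induction k with
    | zero => simp only [Function.iterate_zero, id_eq, pow_zero, one_mul, le_refl]
    | succ k ih =>
      rw [Function.iterate_succ_apply', pow_succ', mul_assoc]
      exact (hS _).trans (mul_le_mul_of_nonneg_left ih hc0)
  intro ε hε
  filter_upwards [(tendsto_pow_atTop_nhds_zero_of_lt_one hc0 hc1).eventually_le_const hε]
    with k hk x
  exact (hiter k x).trans (mul_le_mul_of_nonneg_right hk (norm_nonneg x))

theorem IsEventuallyContracting.prodMap {S : G → G} {T : H → H} (hS : IsEventuallyContracting S)
    (hT : IsEventuallyContracting T) : IsEventuallyContracting (Prod.map S T) := by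
  intro ε hε
  filter_upwards [hS ε hε, hT ε hε] with k hSk hTk p
  rw [Prod.map_iterate]
  refine max_le ((hSk p.1).trans ?_) ((hTk p.2).trans ?_)
  · exact mul_le_mul_of_nonneg_left (norm_fst_le p) hε.le
  · exact mul_le_mul_of_nonneg_left (norm_snd_le p) hε.le

end Contraction

section Attractor

open TopologicalSpace

variable {X : Type*} [MetricSpace X] {ι : Type*}

theorem hausdorffEDist_image_le {f : X → X} {c : ℝ≥0} (hf : LipschitzWith c f)
    (s t : NonemptyCompacts X) : hausdorffEDist (f '' s) (f '' t) ≤ c * edist s t := by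
  have hinf : ∀ s t : NonemptyCompacts X, ∀ x ∈ s, infEDist (f x) (f '' t) ≤ c * edist s t := by
    intro s t x hx
    obtain ⟨y, hy, hxy⟩ := t.isCompact.exists_infEDist_eq_edist t.nonempty x
    calc infEDist (f x) (f '' t) ≤ edist (f x) (f y) :=
          infEDist_le_edist_of_mem (Set.mem_image_of_mem f hy)
      _ ≤ c * infEDist x t := hxy ▸ hf x y
      _ ≤ c * edist s t := by gcongr; exact infEDist_le_hausdorffEDist_of_mem hx
  refine hausdorffEDist_le_of_infEDist (Set.forall_mem_image.2 (hinf s t))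
    (Set.forall_mem_image.2 ?_)
  exact edist_comm s t ▸ hinf t s

variable {G : Type*} [NormedAddCommGroup G] (A : G ≃ₜ+ G) (δ : ι → G)

/-- The nonempty compact solutions `F` of `A F = ⋃ i, (F + δ i)`. -/
structure IsAttractor (F : Set G) : Prop where
  nonempty : F.Nonempty
  isCompact : IsCompact F
  image_eq : A '' F = ⋃ i, (fun x => x + δ i) '' F

/-- The Hutchinson operator `K ↦ ⋃ i, A⁻¹ (K + δ i)`, whose fixed points are the attractors of
`(A, δ)`. -/
def hutchinson [Finite ι] [Nonempty ι] (K : NonemptyCompacts G) : NonemptyCompacts G where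
  carrier := ⋃ i, (fun x => A.symm (x + δ i)) '' K
  isCompact' := isCompact_iUnion fun i => K.isCompact.image (by fun_prop)
  nonempty' := Set.nonempty_iUnion.2 ⟨Classical.arbitrary ι, K.nonempty.image _⟩

variable {A δ}

theorem iterate_symm_add_digitSum_cons {k : ℕ} (x : G) (i : ι) (d : Fin k → ι) :
    A.symm^[k] (A.symm (x + δ i) + digitSum A δ d) =
      A.symm^[k + 1] (x + digitSum A δ (Fin.cons i d : Fin (k + 1) → ι)) := by
  rw [digitSum_succ, Fin.cons_zero, Fin.tail_cons, Function.iterate_succ_apply, ← add_assoc,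
    map_add A.symm (x + δ i), A.symm_apply_apply]

variable [Finite ι] [Nonempty ι]

theorem coe_hutchinson (K : NonemptyCompacts G) :
    (hutchinson A δ K : Set G) = ⋃ i, (fun x => A.symm (x + δ i)) '' K :=
  rfl

theorem isAttractor_coe_iff {K : NonemptyCompacts G} :
    IsAttractor A δ K ↔ hutchinson A δ K = K := by
  have himage : (hutchinson A δ K : Set G) =
      A.toEquiv.symm '' ⋃ i, (fun x => x + δ i) '' K := by
    simp only [coe_hutchinson, Set.image_iUnion, Set.image_image]
    rfl
  rw [← SetLike.coe_set_eq, himage, ← Equiv.eq_image_iff_symm_image_eq, eq_comm]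
  exact ⟨fun h => h.image_eq, fun h => ⟨K.nonempty, K.isCompact, h⟩⟩

theorem coe_hutchinson_iterate (k : ℕ) (K : NonemptyCompacts G) :
    (((hutchinson A δ)^[k] K : NonemptyCompacts G) : Set G) =
      ⋃ d : Fin k → ι, (fun x => A.symm^[k] (x + digitSum A δ d)) '' K := by
  induction k generalizing K with
  | zero => simp only [Function.iterate_zero, id_eq, digitSum_zero, add_zero, Set.image_id',
      Set.iUnion_const]
  | succ k ih =>
    rw [Function.iterate_succ_apply, ih]
    simp only [coe_hutchinson, Set.image_iUnion, Set.image_image, iterate_symm_add_digitSum_cons]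
    rw [Set.iUnion_comm, ← (Fin.consEquiv fun _ => ι).surjective.iUnion_comp, Set.iUnion_prod']
    rfl

theorem exists_contractingWith_hutchinson_iterate (hA : IsEventuallyContracting A.symm) :
    ∃ k, ContractingWith (1 / 2) (hutchinson A δ)^[k] := by
  obtain ⟨k, hk⟩ := (hA (1 / 2) (by norm_num)).exists
  have hlip : LipschitzWith (1 / 2) A.symm^[k] :=
    LipschitzWith.of_dist_le_mul fun x y => by
      simpa only [dist_eq_norm, iterate_map_sub] using! hk (x - y)
  refine ⟨k, by norm_num, fun K L => ?_⟩
  change hausdorffEDist _ _ ≤ _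
  rw [coe_hutchinson_iterate, coe_hutchinson_iterate]
  refine hausdorffEDist_iUnion_le.trans (iSup_le fun d => hausdorffEDist_image_le ?_ K L)
  have hadd : LipschitzWith 1 (· + digitSum A δ d) :=
    LipschitzWith.of_edist_le fun x y => (edist_add_right x y _).le
  exact mul_one (1 / 2 : ℝ≥0) ▸ hlip.comp hadd

theorem existsUnique_isAttractor [CompleteSpace G] (hA : IsEventuallyContracting A.symm) :
    ∃! F, IsAttractor A δ F := by
  obtain ⟨k, hk⟩ := exists_contractingWith_hutchinson_iterate (δ := δ) hA
  refine ⟨_, isAttractor_coe_iff.2 hk.isFixedPt_fixedPoint_iterate, fun F hF => ?_⟩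
  let K : NonemptyCompacts G := ⟨⟨F, hF.isCompact⟩, hF.nonempty⟩
  have hK : hutchinson A δ K = K := isAttractor_coe_iff.1 hF
  exact congrArg SetLike.coe (hk.fixedPoint_unique (Function.IsFixedPt.iterate hK k))

variable {F : Set G}

theorem IsAttractor.eq_iUnion_image (hF : IsAttractor A δ F) (k : ℕ) :
    F = ⋃ d : Fin k → ι, (fun x => A.symm^[k] (x + digitSum A δ d)) '' F := by
  let K : NonemptyCompacts G := ⟨⟨F, hF.isCompact⟩, hF.nonempty⟩
  have hK : hutchinson A δ K = K := isAttractor_coe_iff.1 hF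
  exact (congrArg SetLike.coe (Function.IsFixedPt.iterate hK k)).symm.trans
    (coe_hutchinson_iterate k K)

theorem IsAttractor.image_iterate (hF : IsAttractor A δ F) (k : ℕ) :
    A^[k] '' F = ⋃ d : Fin k → ι, (fun x => x + digitSum A δ d) '' F := by
  conv_lhs => rw [hF.eq_iUnion_image k]
  have hinv := Function.RightInverse.iterate (f := A) (g := A.symm) A.apply_symm_apply k
  simp only [Set.image_iUnion, Set.image_image, hinv _]

theorem IsAttractor.eventually_ball_subset_image_cthickening (hF : IsAttractor A δ F)
    (hA : IsEventuallyContracting A.symm) (r : ℝ) {ε : ℝ} (hε : 0 < ε) :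
    ∀ᶠ k in atTop, ∀ d : Fin k → ι, ball (digitSum A δ d) r ⊆ A^[k] '' cthickening ε F := by
  obtain ⟨y, hy⟩ := hF.nonempty
  rcases le_or_gt r 0 with hr | hr
  · simp only [ball_eq_empty.2 hr, Set.empty_subset, implies_true, Filter.eventually_true]
  filter_upwards [hA (ε / (r + ‖y‖)) (by positivity)] with k hk d z hz
  have hyF : A.symm^[k] (y + digitSum A δ d) ∈ F := by
    rw [hF.eq_iUnion_image k]
    exact Set.mem_iUnion.2 ⟨d, y, hy, rfl⟩
  have hzy : ‖z - (y + digitSum A δ d)‖ ≤ r + ‖y‖ := calc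
    _ = ‖(z - digitSum A δ d) - y‖ := by rw [sub_sub, add_comm y]
    _ ≤ ‖z - digitSum A δ d‖ + ‖y‖ := norm_sub_le _ _
    _ ≤ r + ‖y‖ := by gcongr; exact (mem_ball_iff_norm.1 hz).le
  refine ⟨A.symm^[k] z, mem_cthickening_of_dist_le _ _ _ _ hyF ?_,
    Function.RightInverse.iterate (f := A) (g := A.symm) A.apply_symm_apply k z⟩
  rw [dist_eq_norm, ← iterate_map_sub A.symm]
  calc _ ≤ ε / (r + ‖y‖) * (r + ‖y‖) := (hk _).trans (by gcongr)
    _ = ε := div_mul_cancel₀ _ (by positivity)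

end Attractor

section UniformlyDiscrete

variable {X : Type*} [PseudoMetricSpace X] {M N : Set X}

theorem IsUniformlyDiscrete.mono (hN : IsUniformlyDiscrete N) (h : M ⊆ N) :
    IsUniformlyDiscrete M := by
  obtain ⟨r, hr, hball⟩ := hN
  exact ⟨r, hr, fun c => (hball c).anti (Set.inter_subset_inter_right _ h)⟩

theorem IsUniformlyDiscrete.exists_pairwiseDisjoint_ball (hM : IsUniformlyDiscrete M) :
    ∃ r > 0, M.PairwiseDisjoint fun x => ball x r := by
  obtain ⟨r, hr, hball⟩ := hM
  refine ⟨r, hr, fun x hx y hy hxy => Set.disjoint_left.2 fun c hcx hcy => hxy ?_⟩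
  exact hball c ⟨mem_ball_comm.1 hcx, hx⟩ ⟨mem_ball_comm.1 hcy, hy⟩

theorem IsUniformlyDiscrete.finite_inter (hM : IsUniformlyDiscrete M) {K : Set X}
    (hK : IsCompact K) : (K ∩ M).Finite := by
  obtain ⟨r, hr, hball⟩ := hM
  obtain ⟨t, -, ht, hKt⟩ := hK.finite_cover_balls hr
  refine (ht.biUnion fun c _ => (hball c).finite).subset fun x hx => ?_
  obtain ⟨c, hct, hxc⟩ := Set.mem_iUnion₂.1 (hKt hx.1)
  exact Set.mem_biUnion hct ⟨hxc, hx.2⟩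

end UniformlyDiscrete

section TilingWeight

variable {G : Type*} [AddCommGroup G] [MeasurableSpace G]

/-- A measurable weight whose translates by `Γ` sum to `1`: the weighted analogue of a measurable
fundamental domain of `Γ`, whose indicator function is an example. -/
structure IsTilingWeight (Γ : AddSubgroup G) (w : G → ℝ≥0∞) : Prop where
  measurable : Measurable w
  tsum_eq_one : ∀ x, ∑' γ : Γ, w (x + γ) = 1

variable {Γ Λ : AddSubgroup G} {v w : G → ℝ≥0∞}

theorem IsTilingWeight.tsum_eq_card_quotient (hv : IsTilingWeight Λ v) (h : Λ ≤ Γ) (x : G) :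
    ∑' γ : Γ, v (x + γ) = ENat.card (Γ ⧸ Λ.addSubgroupOf Γ) := by
  have hfiber : ∀ q : Γ ⧸ Λ.addSubgroupOf Γ,
      ∑' γ : QuotientAddGroup.mk ⁻¹' {q}, v (x + (γ : Γ)) = 1 := fun q => by
    obtain ⟨γ, rfl⟩ := QuotientAddGroup.mk_surjective q
    let e : Λ ≃ (QuotientAddGroup.mk ⁻¹' {(γ : Γ ⧸ Λ.addSubgroupOf Γ)} : Set Γ) :=
      (AddSubgroup.addSubgroupOfEquivOfLe h).symm.toEquiv.trans <|
        (AddSubgroup.leftCosetEquivAddSubgroup γ).symm.trans <|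
          Equiv.setCongr (QuotientAddGroup.eq_class_eq_leftCoset _ γ).symm
    rw [← e.tsum_eq, ← hv.tsum_eq_one (x + γ)]
    exact tsum_congr fun ξ => congrArg v (add_assoc x γ ξ).symm
  rw [← ENNReal.tsum_fiberwise _ (QuotientAddGroup.mk : Γ → Γ ⧸ Λ.addSubgroupOf Γ)]
  simp only [hfiber, ENNReal.tsum_const, mul_one]

theorem lintegral_mul_tsum_add {μ : Measure G} [MeasurableAdd G] [μ.IsAddRightInvariant]
    [Countable Γ] (hv : Measurable v) (hw : Measurable w) :
    ∫⁻ x, v x * ∑' γ : Γ, w (x + γ) ∂μ = ∫⁻ x, w x * ∑' γ : Γ, v (x + γ) ∂μ := by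
  have hmeas : ∀ {f g : G → ℝ≥0∞}, Measurable f → Measurable g → ∀ γ : Γ,
      AEMeasurable (fun x => f x * g (x + γ)) μ := fun hf hg γ =>
    (hf.mul (hg.comp (measurable_add_const (γ : G)))).aemeasurable
  simp only [← ENNReal.tsum_mul_left]
  rw [lintegral_tsum (hmeas hv hw), lintegral_tsum (hmeas hw hv), ← (Equiv.neg Γ).tsum_eq]
  refine tsum_congr fun γ => ?_
  rw [← lintegral_add_right_eq_self _ (γ : G)]
  simp only [Equiv.neg_apply, AddSubgroup.coe_neg, add_neg_cancel_right, mul_comm]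

theorem IsTilingWeight.lintegral_eq_card_quotient_mul {μ : Measure G} [MeasurableAdd G]
    [μ.IsAddRightInvariant] [Countable Γ] (hv : IsTilingWeight Λ v) (hw : IsTilingWeight Γ w)
    (h : Λ ≤ Γ) : ∫⁻ x, v x ∂μ = ENat.card (Γ ⧸ Λ.addSubgroupOf Γ) * ∫⁻ x, w x ∂μ := calc
  _ = ∫⁻ x, v x * ∑' γ : Γ, w (x + γ) ∂μ := by simp only [hw.tsum_eq_one, mul_one]
  _ = ∫⁻ x, w x * ∑' γ : Γ, v (x + γ) ∂μ := lintegral_mul_tsum_add hv.measurable hw.measurable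
  _ = _ := by
    simp only [hv.tsum_eq_card_quotient h, lintegral_mul_const _ hw.measurable, mul_comm]

theorem IsTilingWeight.comp_symm {A : G ≃+ G} (hA : Measurable A.symm) (hw : IsTilingWeight Γ w) :
    IsTilingWeight (Γ.map (A : G →+ G)) (w ∘ A.symm) where
  measurable := hw.measurable.comp hA
  tsum_eq_one x := by
    rw [← (A.addSubgroupMap Γ).toEquiv.tsum_eq, ← hw.tsum_eq_one (A.symm x)]
    refine tsum_congr fun γ => congrArg w ?_
    exact (map_add A.symm x _).trans (congrArg _ (A.symm_apply_apply _))

theorem IsTilingWeight.lintegral_ne_zero {μ : Measure G} [NeZero μ] [MeasurableAdd G]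
    [μ.IsAddRightInvariant] [Countable Γ] (hw : IsTilingWeight Γ w) : ∫⁻ x, w x ∂μ ≠ 0 := by
  intro h
  have hzero := lintegral_mul_tsum_add (μ := μ) (Γ := Γ) measurable_one hw.measurable
  simp only [hw.tsum_eq_one, Pi.one_apply, mul_one, lintegral_one, ENNReal.tsum_const,
    lintegral_mul_const _ hw.measurable, h, zero_mul, Measure.measure_univ_eq_zero] at hzero
  exact NeZero.ne μ hzero

theorem isTilingWeight_div {u : G → ℝ≥0∞} [MeasurableAdd G] [Countable Γ] (hu : Measurable u)
    (hne : ∀ x, ∑' γ : Γ, u (x + γ) ≠ 0) (htop : ∀ x, ∑' γ : Γ, u (x + γ) ≠ ⊤) :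
    IsTilingWeight Γ fun x => u x / ∑' γ : Γ, u (x + γ) where
  measurable := hu.div (.tsum fun γ => hu.comp (measurable_add_const (γ : G)))
  tsum_eq_one x := by
    have hinv : ∀ β : Γ, ∑' γ : Γ, u (x + β + γ) = ∑' γ : Γ, u (x + γ) := fun β => by
      rw [← (Equiv.addLeft β).tsum_eq fun γ : Γ => u (x + γ)]
      simp only [Equiv.coe_addLeft, AddSubgroup.coe_add, add_assoc]
    simp only [hinv, ENNReal.div_eq_inv_mul, ENNReal.tsum_mul_left]
    exact ENNReal.inv_mul_cancel (hne x) (htop x)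

end TilingWeight

section UniformLattice

variable {G : Type*} [NormedAddCommGroup G]

/-- A uniformly discrete subgroup whose translates of some compact set cover the whole group. -/
structure IsUniformLattice (Γ : AddSubgroup G) : Prop where
  isUniformlyDiscrete : IsUniformlyDiscrete (Γ : Set G)
  exists_isCompact : ∃ K, IsCompact K ∧ ∀ x, ∃ γ ∈ Γ, x + γ ∈ K

variable [MeasurableSpace G] [BorelSpace G] {Γ : AddSubgroup G} [Countable Γ] {μ : Measure G}

theorem IsUniformLattice.exists_isTilingWeight [IsFiniteMeasureOnCompacts μ]
    (hΓ : IsUniformLattice Γ) : ∃ w, IsTilingWeight Γ w ∧ ∫⁻ x, w x ∂μ ≠ ⊤ := by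
  obtain ⟨K, hK, hcover⟩ := hΓ.exists_isCompact
  let N : G → ℝ≥0∞ := fun x => ∑' γ : Γ, K.indicator 1 (x + γ)
  have hN : ∀ x, N x = ({γ : Γ | x + (γ : G) ∈ K}.encard : ℝ≥0∞) := fun x => by
    rw [← ENNReal.tsum_set_one, tsum_subtype _ fun _ => 1]
    rfl
  have hfinite : ∀ x, {γ : Γ | x + (γ : G) ∈ K}.Finite := fun x => by
    have hshift : IsCompact ((x + ·) ⁻¹' K) := (Homeomorph.addLeft x).isCompact_preimage.2 hK
    exact ((hΓ.isUniformlyDiscrete.finite_inter hshift).preimage Subtype.val_injective.injOn).subset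
      fun γ hγ => ⟨hγ, γ.2⟩
  have hNtop : ∀ x, N x ≠ ⊤ := fun x => by
    rw [hN, ← (hfinite x).cast_ncard_eq]
    exact ENNReal.natCast_ne_top _
  have hone : ∀ x, 1 ≤ N x := fun x => by
    obtain ⟨γ, hγ, hx⟩ := hcover x
    have hx' : {γ : Γ | x + (γ : G) ∈ K}.Nonempty := ⟨⟨γ, hγ⟩, hx⟩
    rw [hN]
    exact_mod_cast Set.one_le_encard_iff_nonempty.2 hx'
  refine ⟨_, isTilingWeight_div (measurable_one.indicator hK.measurableSet)
    (fun x => (one_pos.trans_le (hone x)).ne') hNtop, ?_⟩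
  have hle : ∀ x, K.indicator 1 x / N x ≤ K.indicator 1 x := fun x =>
    (ENNReal.div_le_div_left (hone x) _).trans_eq (div_one _)
  refine ((lintegral_mono hle).trans_lt ?_).ne
  rw [lintegral_indicator_one hK.measurableSet]
  exact hK.measure_lt_top

theorem lintegral_comp_symm [LocallyCompactSpace G] [μ.IsAddHaarMeasure] [μ.Regular]
    (A : G ≃ₜ+ G) (w : G → ℝ≥0∞) :
    ∫⁻ x, w (A.symm x) ∂μ = addEquivAddHaarChar A * ∫⁻ x, w x ∂μ := by
  conv_lhs => rw [← addEquivAddHaarChar_smul_map μ A, lintegral_smul_measure]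
  have h := A.toHomeomorph.toMeasurableEquiv.measurableEmbedding.lintegral_map (μ := μ)
    fun x => w (A.symm x)
  exact congrArg (_ * ·) (h.trans (lintegral_congr fun x => congrArg w (A.symm_apply_apply x)))

theorem IsUniformLattice.addHaarChar_eq_card_quotient [LocallyCompactSpace G]
    (hΓ : IsUniformLattice Γ) (A : G ≃ₜ+ G) (hA : Γ.map (A : G →+ G) ≤ Γ) :
    (addEquivAddHaarChar A : ℝ≥0∞) = ENat.card (Γ ⧸ (Γ.map (A : G →+ G)).addSubgroupOf Γ) := by
  obtain ⟨w, hw, hwtop⟩ := hΓ.exists_isTilingWeight (μ := Measure.addHaar)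
  have hwA : IsTilingWeight (Γ.map (A : G →+ G)) (w ∘ A.symm) :=
    hw.comp_symm (A := A.toAddEquiv) A.symm.continuous.measurable
  rw [← ENNReal.mul_left_inj hw.lintegral_ne_zero hwtop, ← lintegral_comp_symm]
  exact hwA.lintegral_eq_card_quotient_mul hw hA

theorem IsUniformLattice.measure_image [LocallyCompactSpace G] [μ.IsAddHaarMeasure] [μ.Regular]
    (hΓ : IsUniformLattice Γ) (A : G ≃ₜ+ G) (hA : Γ.map (A : G →+ G) ≤ Γ) (s : Set G) :
    μ (A '' s) = ENat.card (Γ ⧸ (Γ.map (A : G →+ G)).addSubgroupOf Γ) * μ s := by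
  rw [← hΓ.addHaarChar_eq_card_quotient A hA, ← addEquivAddHaarChar_smul_preimage μ A,
    Set.preimage_image_eq _ A.injective]
  rfl

end UniformLattice

section AttractorMeasure

variable {G : Type*} [NormedAddCommGroup G] [MeasurableSpace G] {μ : Measure G} {A : G ≃ₜ+ G}

theorem measure_image_iterate {c : ℝ≥0∞} (hμ : ∀ s, μ (A '' s) = c * μ s) (k : ℕ) (s : Set G) :
    μ (A^[k] '' s) = c ^ k * μ s := by
  induction k with
  | zero => simp only [Function.iterate_zero, Set.image_id, pow_zero, one_mul]
  | succ k ih => rw [Function.iterate_succ', Set.image_comp, hμ, ih, pow_succ', mul_assoc]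

variable [BorelSpace G] [μ.IsAddHaarMeasure] {ι : Type*} [Fintype ι] [Nonempty ι] {δ : ι → G}
  {F : Set G}

theorem IsAttractor.digitSum_injective_of_measure_pos (hF : IsAttractor A δ F)
    (hμ : ∀ s, μ (A '' s) = Fintype.card ι * μ s) (hpos : 0 < μ F) (k : ℕ) :
    Function.Injective (digitSum A δ : (Fin k → ι) → G) := by
  classical
  let E : Finset G := Finset.univ.image (digitSum A δ : (Fin k → ι) → G)
  have hcover : A^[k] '' F = ⋃ e ∈ E, (fun x => x + e) '' F := by
    simp only [hF.image_iterate k, E, Finset.set_biUnion_finset_image, Finset.mem_univ,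
      Set.iUnion_true]
  have hmeasure : (Fintype.card ι : ℝ≥0∞) ^ k * μ F ≤ E.card * μ F := calc
    _ = μ (⋃ e ∈ E, (fun x => x + e) '' F) := by rw [← measure_image_iterate hμ, hcover]
    _ ≤ ∑ e ∈ E, μ ((fun x => x + e) '' F) := measure_biUnion_finset_le _ _
    _ = E.card * μ F := by
      simp only [Set.image_add_right, measure_preimage_add_right, Finset.sum_const, nsmul_eq_mul]
  rw [ENNReal.mul_le_mul_iff_left hpos.ne' hF.isCompact.measure_lt_top.ne] at hmeasure
  have hcard : (Finset.univ : Finset (Fin k → ι)).card ≤ E.card := by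
    rw [Finset.card_univ, Fintype.card_fun, Fintype.card_fin]
    exact_mod_cast hmeasure
  exact Set.injOn_univ.1 (Finset.coe_univ (α := Fin k → ι) ▸
    Finset.card_image_iff.1 (Finset.card_image_le.antisymm hcard))

theorem IsAttractor.measure_ball_le_measure_cthickening (hF : IsAttractor A δ F)
    (hA : IsEventuallyContracting A.symm) (hμ : ∀ s, μ (A '' s) = Fintype.card ι * μ s) {r ε : ℝ}
    (hdisj : ∀ k, Pairwise fun d e : Fin k → ι =>
      Disjoint (ball (digitSum A δ d) r) (ball (digitSum A δ e) r)) (hε : 0 < ε) :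
    μ (ball 0 r) ≤ μ (cthickening ε F) := by
  obtain ⟨k, hk⟩ := (hF.eventually_ball_subset_image_cthickening hA r hε).exists
  have hcard : (Fintype.card ι : ℝ≥0∞) ≠ 0 := Nat.cast_ne_zero.2 Fintype.card_ne_zero
  refine (ENNReal.mul_le_mul_iff_right (pow_ne_zero k hcard)
    (ENNReal.pow_ne_top (ENNReal.natCast_ne_top _))).1 ?_
  calc (Fintype.card ι : ℝ≥0∞) ^ k * μ (ball 0 r)
      = μ (⋃ d : Fin k → ι, ball (digitSum A δ d) r) := by
        rw [measure_iUnion (hdisj k) fun _ => measurableSet_ball]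
        simp only [Measure.addHaar_ball_center, tsum_fintype, Finset.sum_const, Finset.card_univ,
          Fintype.card_fun, Fintype.card_fin, nsmul_eq_mul, Nat.cast_pow]
    _ ≤ μ (A^[k] '' cthickening ε F) := measure_mono (Set.iUnion_subset hk)
    _ = (Fintype.card ι : ℝ≥0∞) ^ k * μ (cthickening ε F) := measure_image_iterate hμ k _

theorem IsAttractor.measure_pos [LocallyCompactSpace G] (hF : IsAttractor A δ F)
    (hA : IsEventuallyContracting A.symm) (hμ : ∀ s, μ (A '' s) = Fintype.card ι * μ s)
    (hinj : ∀ k, Function.Injective (digitSum A δ : (Fin k → ι) → G))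
    (hdisc : IsUniformlyDiscrete (⋃ k, Set.range (digitSum A δ : (Fin k → ι) → G))) :
    0 < μ F := by
  obtain ⟨r, hr, hdisj⟩ := hdisc.exists_pairwiseDisjoint_ball
  have hball : ∀ ε > 0, μ (ball 0 r) ≤ μ (cthickening ε F) := fun ε hε =>
    hF.measure_ball_le_measure_cthickening hA hμ (fun k d e hde =>
      hdisj (Set.mem_iUnion.2 ⟨k, d, rfl⟩) (Set.mem_iUnion.2 ⟨k, e, rfl⟩) ((hinj k).ne hde)) hε
  have hlim : Tendsto (fun ε => μ (cthickening ε F)) (𝓝[>] 0) (𝓝 (μ F)) := by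
    obtain ⟨ε, hε, hcompact⟩ := hF.isCompact.exists_isCompact_cthickening
    exact (tendsto_measure_cthickening_of_isClosed ⟨ε, hε, hcompact.measure_lt_top.ne⟩
      hF.isCompact.isClosed).mono_left nhdsWithin_le_nhds
  exact (measure_ball_pos μ 0 hr).trans_le
    (ge_of_tendsto hlim (eventually_mem_nhdsWithin.mono hball))

theorem IsAttractor.measure_pos_iff [LocallyCompactSpace G] [μ.Regular] {Γ : AddSubgroup G}
    [Countable Γ] (hF : IsAttractor A δ F) (hA : IsEventuallyContracting A.symm)
    (hΓ : IsUniformLattice Γ) (hmap : Γ.map (A : G →+ G) ≤ Γ)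
    (hindex : (Γ.map (A : G →+ G)).relIndex Γ = Fintype.card ι) (hδ : ∀ i, δ i ∈ Γ) :
    0 < μ F ↔ ∀ k, Function.Injective (digitSum A δ : (Fin k → ι) → G) := by
  have hfinite : Finite (Γ ⧸ (Γ.map (A : G →+ G)).addSubgroupOf Γ) :=
    Nat.finite_of_card_ne_zero (hindex.trans_ne Fintype.card_ne_zero)
  have hμ : ∀ s, μ (A '' s) = Fintype.card ι * μ s := fun s => by
    rw [hΓ.measure_image A hmap, ENat.card_eq_coe_natCard, ← hindex]
    rfl
  refine ⟨hF.digitSum_injective_of_measure_pos hμ, fun hinj => hF.measure_pos hA hμ hinj ?_⟩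
  refine hΓ.isUniformlyDiscrete.mono (Set.iUnion_subset fun k => Set.range_subset_iff.2 fun d => ?_)
  exact digitSum_mem (Γ := Γ.toAddSubmonoid) (fun x hx => hmap ⟨x, hx, rfl⟩) hδ d

end AttractorMeasure

section BoundedDenominators

variable {n : ℕ} {M : Matrix (Fin n) (Fin n) ℚ} {v : Fin n → ℚ} {k : ℕ}

theorem act_act (M N : Matrix (Fin n) (Fin n) ℚ) (v : Fin n → ℚ) :
    act M (act N v) = act (M * N) v := by
  rw [act_mul, AddMonoidHom.comp_apply]

/-- The sum `ℤⁿ + M ℤⁿ + ⋯ + M ^ (k - 1) ℤⁿ`, exhausting `polyLattice M` as `k` grows. -/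
def truncLattice (M : Matrix (Fin n) (Fin n) ℚ) : ℕ → AddSubgroup (Fin n → ℚ)
  | 0 => ⊥
  | k + 1 => truncLattice M k ⊔ (intLattice n).map (act (M ^ k))

theorem mem_truncLattice_succ :
    v ∈ truncLattice M (k + 1) ↔ ∃ w ∈ truncLattice M k, ∃ u ∈ intLattice n,
      w + act (M ^ k) u = v := by
  simp only [truncLattice, AddSubgroup.mem_sup, AddSubgroup.mem_map, exists_exists_and_eq_and]

theorem truncLattice_mono (M : Matrix (Fin n) (Fin n) ℚ) : Monotone (truncLattice M) :=
  monotone_nat_of_le_succ fun _ => le_sup_left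

theorem act_pow_mem_truncLattice (M : Matrix (Fin n) (Fin n) ℚ) {i : ℕ} (hik : i < k)
    (hv : v ∈ intLattice n) : act (M ^ i) v ∈ truncLattice M k :=
  truncLattice_mono M hik (mem_truncLattice_succ.2 ⟨0, zero_mem _, v, hv, zero_add _⟩)

theorem act_mem_truncLattice_succ (hv : v ∈ truncLattice M k) :
    act M v ∈ truncLattice M (k + 1) := by
  induction k generalizing v with
  | zero => simp only [AddSubgroup.mem_bot.1 hv, map_zero, zero_mem]
  | succ k ih =>
    obtain ⟨w, hw, u, hu, rfl⟩ := mem_truncLattice_succ.1 hv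
    rw [map_add, act_act, ← pow_succ']
    exact add_mem (truncLattice_mono M (Nat.le_succ _) (ih hw))
      (act_pow_mem_truncLattice M (Nat.lt_succ_self _) hu)

theorem act_pow_mem_truncLattice_add (hv : v ∈ truncLattice M k) (j : ℕ) :
    act (M ^ j) v ∈ truncLattice M (k + j) := by
  induction j with
  | zero => rwa [pow_zero, act_one]
  | succ j ih =>
    rw [pow_succ', ← act_act]
    exact act_mem_truncLattice_succ ih

theorem act_pow_mem_truncLattice_of_mem_inv (hM : IsUnit M.det)
    (hv : v ∈ truncLattice M⁻¹ k) : act (M ^ k) v ∈ truncLattice M (k + 1) := by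
  induction k generalizing v with
  | zero => simp only [AddSubgroup.mem_bot.1 hv, map_zero, zero_mem]
  | succ k ih =>
    obtain ⟨w, hw, u, hu, rfl⟩ := mem_truncLattice_succ.1 hv
    have hcancel : M ^ (k + 1) * M⁻¹ ^ k = M ^ 1 := by
      rw [Matrix.inv_pow', ← Matrix.pow_sub' M hM (Nat.le_add_right k 1),
        Nat.add_sub_cancel_left]
    rw [map_add, act_act _ _ u, hcancel, pow_succ', ← act_act]
    exact add_mem (act_mem_truncLattice_succ (ih hw)) (act_pow_mem_truncLattice M (by lia) hu)

theorem exists_mem_truncLattice (hv : v ∈ polyLattice M) : ∃ k, v ∈ truncLattice M k := by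
  have hle : polyLattice M ≤ ⨆ k, truncLattice M k := iSup_le fun k =>
    le_sup_right.trans (le_iSup (truncLattice M) (k + 1))
  exact (AddSubgroup.mem_iSup_of_directed (truncLattice_mono M).directed_le).1 (hle hv)

/-- The inclusion of `ℤⁿ` in `ℚⁿ`; its range is `intLattice n`. -/
def intCastVec (n : ℕ) : (Fin n → ℤ) →+ (Fin n → ℚ) :=
  (Int.castAddHom ℚ).compLeft (Fin n)

theorem mem_intLattice_iff : v ∈ intLattice n ↔ ∃ z, intCastVec n z = v := by
  constructor
  · intro h
    choose z hz using h
    exact ⟨z, funext fun i => (hz i).symm⟩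
  · rintro ⟨z, rfl⟩ i
    exact ⟨z i, rfl⟩

-- The groups of `z ∈ ℤⁿ` for which `M ^ k z` can be rewritten with lower powers of `M` increase
-- with `k`, so they stabilize because `ℤⁿ` is Noetherian.
theorem exists_forall_mem_truncLattice_of_act_mem (M : Matrix (Fin n) (Fin n) ℚ) :
    ∃ k₀, ∀ k ≥ k₀, ∀ v ∈ truncLattice M (k + 1), act M v ∈ truncLattice M (k + 1) →
      v ∈ truncLattice M k := by
  let N : ℕ →o Submodule ℤ (Fin n → ℤ) :=
    { toFun := fun k => AddSubgroup.toIntSubmodule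
        ((truncLattice M k).comap ((act (M ^ k)).comp (intCastVec n)))
      monotone' := monotone_nat_of_le_succ fun k z hz => by
        change act (M ^ (k + 1)) (intCastVec n z) ∈ truncLattice M (k + 1)
        rw [pow_succ', ← act_act]
        exact act_mem_truncLattice_succ hz }
  obtain ⟨k₀, hk₀⟩ := monotone_stabilizes_iff_noetherian.2 inferInstance N
  refine ⟨k₀, fun k hk v hv hMv => ?_⟩
  obtain ⟨w, hw, u, hu, rfl⟩ := mem_truncLattice_succ.1 hv
  obtain ⟨z, rfl⟩ := mem_intLattice_iff.1 hu
  rw [map_add, add_mem_cancel_left (act_mem_truncLattice_succ hw), act_act, ← pow_succ'] at hMv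
  have hz : z ∈ N (k + 1) := hMv
  rw [← hk₀ (k + 1) (Nat.le_succ_of_le hk), hk₀ k hk] at hz
  exact add_mem hw hz

theorem exists_polyLattice_inf_le_truncLattice (hM : IsUnit M.det) :
    ∃ k, polyLattice M ⊓ polyLattice M⁻¹ ≤ truncLattice M k := by
  obtain ⟨k₀, hk₀⟩ := exists_forall_mem_truncLattice_of_act_mem M
  refine ⟨k₀ + 1, fun v ⟨hv, hv'⟩ => ?_⟩
  obtain ⟨l, hl⟩ := exists_mem_truncLattice hv'
  have hdescend : ∀ k ≥ k₀ + 1, v ∈ truncLattice M (k + 1) → v ∈ truncLattice M k := by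
    intro k hk hvk
    have hpow : act (M ^ l) v ∈ truncLattice M (k + l) :=
      truncLattice_mono M (by lia) (act_pow_mem_truncLattice_of_mem_inv hM hl)
    have hzero : act (M ^ 0) v ∈ truncLattice M (k + 0) :=
      Nat.decreasingInduction' (P := fun j => act (M ^ j) v ∈ truncLattice M (k + j))
        (fun j _ _ hj => hk₀ (k + j) (by lia) _
          (Nat.add_right_comm k j 1 ▸ act_pow_mem_truncLattice_add hvk j)
          (by rwa [act_act, ← pow_succ'])) l.zero_le hpow
    rwa [pow_zero, act_one] at hzero
  obtain ⟨k, hk⟩ := exists_mem_truncLattice hv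
  exact Nat.decreasingInduction' (fun j _ hj => hdescend j hj) (Nat.le_add_right (k₀ + 1) k)
    (truncLattice_mono M (Nat.le_add_left k (k₀ + 1)) hk)

theorem exists_nsmul_mem_intLattice_of_mem_truncLattice (M : Matrix (Fin n) (Fin n) ℚ) (k : ℕ) :
    ∃ m : ℕ, m ≠ 0 ∧ ∀ v ∈ truncLattice M k, m • v ∈ intLattice n := by
  induction k with
  | zero =>
    refine ⟨1, one_ne_zero, fun v hv => ?_⟩
    rw [AddSubgroup.mem_bot.1 hv, smul_zero]
    exact zero_mem _
  | succ k ih =>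
    obtain ⟨m, hm, h⟩ := ih
    obtain ⟨m', hm', h'⟩ := exists_int_matrix (M ^ k)
    refine ⟨m * m', mul_ne_zero hm hm', fun v hv => ?_⟩
    obtain ⟨w, hw, u, hu, rfl⟩ := mem_truncLattice_succ.1 hv
    rw [smul_add, mul_smul m m' (act _ u), mul_comm, mul_smul]
    exact add_mem (nsmul_mem (h w hw) _) (nsmul_mem (h' u hu) _)

theorem exists_nsmul_mem_intLattice_of_mem_polyLattice_inf (hM : IsUnit M.det) :
    ∃ m : ℕ, m ≠ 0 ∧ ∀ v ∈ polyLattice M ⊓ polyLattice M⁻¹, m • v ∈ intLattice n := by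
  obtain ⟨k, hk⟩ := exists_polyLattice_inf_le_truncLattice hM
  obtain ⟨m, hm, hmem⟩ := exists_nsmul_mem_intLattice_of_mem_truncLattice M k
  exact ⟨m, hm, fun v hv => hmem v (hk hv)⟩

end BoundedDenominators

section BadicSeries

variable {n : ℕ} {A : Matrix (Fin n) (Fin n) ℚ} (hA : IsExpanding A)

theorem act_inv_map_laurentLattice_le {M : Matrix (Fin n) (Fin n) ℚ} (hM : IsUnit M.det) :
    (laurentLattice M).map (act M⁻¹) ≤ laurentLattice M := by
  rw [laurentLattice, AddSubgroup.map_iSup]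
  refine iSup_le fun k => ?_
  rw [AddSubgroup.map_map, ← act_mul, ← Matrix.zpow_neg_one, ← Matrix.zpow_add hM]
  exact le_iSup (fun k : ℤ => (intLattice n).map (act (M ^ k))) (-1 + k)

/-- Multiplication by `A⁻¹` on `ℤⁿ(A)`. -/
def divLaurent : Laurent hA →+ Laurent hA :=
  ((act A⁻¹).comp (laurentLattice A).subtype).codRestrict (laurentLattice A)
    fun x => act_inv_map_laurentLattice_le hA.isUnit_det ⟨x, x.2, rfl⟩

theorem mulLaurent_divLaurent (y : Laurent hA) : mulLaurent hA (divLaurent hA y) = y := by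
  refine Subtype.ext ?_
  change act A (act A⁻¹ (Laurent.vec hA y)) = Laurent.vec hA y
  rw [act_act, Matrix.mul_nonsing_inv _ hA.isUnit_det, act_one, AddMonoidHom.id_apply]

theorem divLaurent_mulLaurent (y : Laurent hA) : divLaurent hA (mulLaurent hA y) = y := by
  refine Subtype.ext ?_
  change act A⁻¹ (act A (Laurent.vec hA y)) = Laurent.vec hA y
  rw [act_act, Matrix.nonsing_inv_mul _ hA.isUnit_det, act_one, AddMonoidHom.id_apply]

theorem vec_divLaurent_mem {y : Laurent hA} {k : ℤ} (h : Laurent.vec hA y ∈ filt A⁻¹ k) :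
    Laurent.vec hA (divLaurent hA y) ∈ filt A⁻¹ (k + 1) := by
  have hmap := map_filt (isUnit_det_inv hA) 1 k
  rw [zpow_one, add_comm] at hmap
  rw [← hmap]
  exact ⟨_, h, rfl⟩

theorem norm_divLaurent_le (y : Laurent hA) : ‖divLaurent hA y‖ ≤ 1 / 2 * ‖y‖ := by
  rcases nu_cases hA y with hy | ⟨j, hj, hj'⟩
  · have hzero : ‖divLaurent hA y‖ = 0 := by
      rw [norm_eq_badicAbs, badicAbs,
        nu_eq_top hA fun k => sub_add_cancel k 1 ▸ vec_divLaurent_mem hA (hy (k - 1))]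
      rfl
    rw [hzero]
    positivity
  · have hb : 2 ≤ residueCard A⁻¹ :=
      Nat.lt_of_le_of_ne (residueCard_pos (isUnit_det_inv hA))
        fun h => hj' (filt_le_succ hA h.symm j hj)
    have hb' : (2 : ℝ) ≤ residueCard A⁻¹ := mod_cast hb
    calc ‖divLaurent hA y‖
        ≤ (residueCard A⁻¹ : ℝ) ^ (-(j + 1)) := badicAbs_le hA (vec_divLaurent_mem hA hj)
      _ = (residueCard A⁻¹ : ℝ)⁻¹ * (residueCard A⁻¹ : ℝ) ^ (-j) := by
        rw [neg_add_rev, zpow_add₀ (by positivity), zpow_neg_one]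
      _ ≤ 1 / 2 * ‖y‖ := by
        rw [one_div]
        gcongr
        exact le_badicAbs hA hj'

theorem continuous_divLaurent : Continuous (divLaurent hA) :=
  AddMonoidHomClass.continuous_of_bound _ _ (norm_divLaurent_le hA)

/-- Multiplication by `A⁻¹` on `ℤⁿ((B))`, the continuous extension of the one on `ℤⁿ(A)`. -/
def divBadic : BadicSeries hA →+ BadicSeries hA :=
  (divLaurent hA).completion (continuous_divLaurent hA)

theorem mulBadic_coe (y : Laurent hA) : mulBadic hA y = (mulLaurent hA y : BadicSeries hA) :=
  AddMonoidHom.completion_coe _ (continuous_mulLaurent hA) y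

theorem divBadic_coe (y : Laurent hA) : divBadic hA y = (divLaurent hA y : BadicSeries hA) :=
  AddMonoidHom.completion_coe _ (continuous_divLaurent hA) y

theorem continuous_mulBadic : Continuous (mulBadic hA) :=
  AddMonoidHom.continuous_completion _ (continuous_mulLaurent hA)

theorem continuous_divBadic : Continuous (divBadic hA) :=
  AddMonoidHom.continuous_completion _ (continuous_divLaurent hA)

theorem mulBadic_divBadic (y : BadicSeries hA) : mulBadic hA (divBadic hA y) = y := by
  induction y using UniformSpace.Completion.induction_on with
  | hp => exact isClosed_eq ((continuous_mulBadic hA).comp (continuous_divBadic hA)) continuous_id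
  | ih y => rw [divBadic_coe, mulBadic_coe, mulLaurent_divLaurent]

theorem divBadic_mulBadic (y : BadicSeries hA) : divBadic hA (mulBadic hA y) = y := by
  induction y using UniformSpace.Completion.induction_on with
  | hp => exact isClosed_eq ((continuous_divBadic hA).comp (continuous_mulBadic hA)) continuous_id
  | ih y => rw [mulBadic_coe, divBadic_coe, divLaurent_mulLaurent]

theorem norm_divBadic_le (y : BadicSeries hA) : ‖divBadic hA y‖ ≤ 1 / 2 * ‖y‖ := by
  induction y using UniformSpace.Completion.induction_on with
  | hp => exact isClosed_le (continuous_divBadic hA).norm (continuous_norm.const_mul _)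
  | ih y =>
    rw [divBadic_coe, UniformSpace.Completion.norm_coe, UniformSpace.Completion.norm_coe]
    exact norm_divLaurent_le hA y

instance : LocallyCompactSpace (BadicSeries hA) :=
  (isCompact_unitBall hA).locallyCompactSpace_of_mem_nhds_of_addGroup
    (closedBall_mem_nhds 0 one_pos)

instance : Countable (Laurent hA) := inferInstanceAs (Countable (laurentLattice A))

instance : SecondCountableTopology (BadicSeries hA) :=
  UniformSpace.secondCountable_of_separable _

instance : (badicMeasure hA).IsAddHaarMeasure :=
  inferInstanceAs (Measure.addHaarMeasure (badicIntegers hA)).IsAddHaarMeasure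

end BadicSeries

section Euclidean

variable {n : ℕ} {A : Matrix (Fin n) (Fin n) ℚ}

theorem tendsto_pow_nhds_zero_of_spectrum_lt_one {R : Type*} [NormedRing R] [NormedAlgebra ℂ R]
    [CompleteSpace R] {x : R} (hx : ∀ z ∈ spectrum ℂ x, ‖z‖ < 1) :
    Tendsto (fun k : ℕ => x ^ k) atTop (𝓝 0) := by
  nontriviality R
  have hradius : spectralRadius ℂ x < 1 :=
    spectrum.spectralRadius_lt_of_forall_lt x (r := 1) fun z hz => hx z hz
  obtain ⟨θ, hθ, hθ1⟩ := ENNReal.lt_iff_exists_nnreal_btwn.1 hradius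
  have hgelfand : ∀ᶠ k : ℕ in atTop, ‖x ^ k‖₊ ≤ θ ^ k := by
    filter_upwards
      [(spectrum.pow_nnnorm_pow_one_div_tendsto_nhds_spectralRadius x).eventually_lt_const hθ,
      eventually_ge_atTop 1] with k hk hk1
    have hpow := ENNReal.rpow_le_rpow hk.le (z := k) (by positivity)
    rw [← ENNReal.rpow_mul, one_div_mul_cancel (by positivity), ENNReal.rpow_one,
      ENNReal.rpow_natCast] at hpow
    exact mod_cast hpow
  exact squeeze_zero_norm' hgelfand
    (tendsto_pow_atTop_nhds_zero_of_lt_one θ.2 (mod_cast hθ1))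

theorem isEventuallyContracting_of_tendsto_pow {E : Type*} [SeminormedAddCommGroup E]
    [NormedSpace ℝ E] {T : E →L[ℝ] E} (hT : Tendsto (fun k : ℕ => T ^ k) atTop (𝓝 0)) :
    IsEventuallyContracting T := by
  intro ε hε
  filter_upwards [hT.norm.eventually_le_const (norm_zero (E := E →L[ℝ] E) ▸ hε)] with k hk x
  rw [← FunLike.coe_pow_eq_iterate]
  exact (T ^ k).le_of_opNorm_le hk x

theorem IsExpanding.norm_lt_one_of_mem_spectrum_inv (hA : IsExpanding A) {z : ℂ}
    (hz : z ∈ spectrum ℂ (A⁻¹.map (algebraMap ℚ ℂ))) : ‖z‖ < 1 := by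
  let u : (Matrix (Fin n) (Fin n) ℂ)ˣ :=
    Units.map (algebraMap ℚ ℂ).mapMatrix.toMonoidHom (Matrix.nonsingInvUnit A hA.isUnit_det)
  have hz' : z ∈ spectrum ℂ (↑u⁻¹ : Matrix (Fin n) (Fin n) ℂ) := hz
  rw [← spectrum.map_inv, Set.mem_inv] at hz'
  have hlt : 1 < ‖z‖⁻¹ := norm_inv z ▸ hA _ hz'
  exact (one_lt_inv_iff₀.1 hlt).2

/-- The ring homomorphism sending a rational matrix to the operator it defines on Euclidean
space. -/
def euclAct (n : ℕ) : Matrix (Fin n) (Fin n) ℚ →+*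
    (EuclideanSpace ℝ (Fin n) →L[ℝ] EuclideanSpace ℝ (Fin n)) :=
  (Matrix.toEuclideanCLM (n := Fin n) (𝕜 := ℝ) : _ →+* _).comp (algebraMap ℚ ℝ).mapMatrix

section

attribute [local instance] Matrix.linftyOpNormedRing Matrix.linftyOpNormedAlgebra

theorem IsExpanding.tendsto_inv_pow (hA : IsExpanding A) :
    Tendsto (fun k : ℕ => (A⁻¹.map (algebraMap ℚ ℂ)) ^ k) atTop (𝓝 0) := by
  have : CompleteSpace (Matrix (Fin n) (Fin n) ℂ) := FiniteDimensional.complete ℂ _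
  exact tendsto_pow_nhds_zero_of_spectrum_lt_one fun z hz => hA.norm_lt_one_of_mem_spectrum_inv hz

end

theorem IsExpanding.isEventuallyContracting_euclAct_inv (hA : IsExpanding A) :
    IsEventuallyContracting (euclAct n A⁻¹) := by
  have hre : ∀ k : ℕ, ((A⁻¹.map (algebraMap ℚ ℂ)) ^ k).map Complex.re =
      (A⁻¹ ^ k).map (algebraMap ℚ ℝ) := fun k => by
    rw [← RingHom.mapMatrix_apply, ← map_pow]
    ext i j
    exact Complex.ratCast_re _
  have hreal : Tendsto (fun k : ℕ => (A⁻¹ ^ k).map (algebraMap ℚ ℝ)) atTop (𝓝 0) := by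
    have hmap := ((continuous_id.matrix_map Complex.continuous_re).tendsto 0).comp
      hA.tendsto_inv_pow
    simpa only [Function.comp_def, id_eq, hre, Matrix.map_zero _ Complex.zero_re] using hmap
  have hcont : Continuous (Matrix.toEuclideanCLM (n := Fin n) (𝕜 := ℝ)) :=
    LinearMap.continuous_of_finiteDimensional
      (Matrix.toEuclideanCLM (n := Fin n) (𝕜 := ℝ)).toAlgEquiv.toLinearMap
  refine isEventuallyContracting_of_tendsto_pow ?_
  simp only [← map_pow]
  exact map_zero (Matrix.toEuclideanCLM (n := Fin n) (𝕜 := ℝ)) ▸ (hcont.tendsto 0).comp hreal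

end Euclidean

section RepSpace

open scoped Pointwise

variable {n : ℕ} {A : Matrix (Fin n) (Fin n) ℚ} (hA : IsExpanding A)

/-- Multiplication by `A` on the representation space, as an automorphism of topological groups. -/
def repEquiv : RepSpace hA ≃ₜ+ RepSpace hA where
  toFun := mulRep hA
  invFun := Prod.map (euclAct n A⁻¹) (divBadic hA)
  left_inv p := by
    refine Prod.ext ?_ (divBadic_mulBadic hA p.2)
    change (euclAct n A⁻¹ * euclAct n A) p.1 = p.1
    rw [← map_mul, Matrix.nonsing_inv_mul _ hA.isUnit_det, map_one]
    rfl
  right_inv p := by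
    refine Prod.ext ?_ (mulBadic_divBadic hA p.2)
    change (euclAct n A * euclAct n A⁻¹) p.1 = p.1
    rw [← map_mul, Matrix.mul_nonsing_inv _ hA.isUnit_det, map_one]
    rfl
  map_add' p q := Prod.ext (map_add (euclAct n A) p.1 q.1) (map_add (mulBadic hA) p.2 q.2)
  continuous_toFun := (euclAct n A).continuous.prodMap (continuous_mulBadic hA)
  continuous_invFun := (euclAct n A⁻¹).continuous.prodMap (continuous_divBadic hA)

theorem isEventuallyContracting_repEquiv_symm : IsEventuallyContracting (repEquiv hA).symm :=
  hA.isEventuallyContracting_euclAct_inv.prodMap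
    (isEventuallyContracting_of_norm_le (by norm_num) (by norm_num) (norm_divBadic_le hA))

instance : (repMeasure hA).IsAddHaarMeasure :=
  inferInstanceAs ((volume : Measure (EuclideanSpace ℝ (Fin n))).prod
    (badicMeasure hA)).IsAddHaarMeasure

/-- The embedding `φ` restricted to `ℤⁿ[A]`. -/
def diagPoly : polyLattice A →+ RepSpace hA where
  toFun x := diag hA (inclLaurent hA x)
  map_zero' := Prod.ext (PiLp.ext fun _ => Rat.cast_zero) UniformSpace.Completion.coe_zero
  map_add' x y := Prod.ext (PiLp.ext fun _ => Rat.cast_add _ _)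
    (UniformSpace.Completion.coe_add (inclLaurent hA x) (inclLaurent hA y))

theorem diagPoly_injective : Function.Injective (diagPoly hA) := fun _ _ h =>
  Subtype.ext <| funext fun i => Rat.cast_injective (α := ℝ) <|
    congrArg (fun p : RepSpace hA => p.1 i) h

theorem semiconj_diagPoly : Function.Semiconj (diagPoly hA) (mulPoly A) (repEquiv hA) := by
  refine fun x => Prod.ext (PiLp.ext fun i => ?_) (mulBadic_coe hA (inclLaurent hA x)).symm
  change ((∑ j, A i j * x.1 j : ℚ) : ℝ) = ∑ j, ((A i j : ℚ) : ℝ) * ((x.1 j : ℚ) : ℝ)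
  push_cast
  rfl

theorem digitSum_diagPoly {D : Finset (polyLattice A)} {k : ℕ} (d : Fin k → D) :
    digitSum (repEquiv hA) (fun d : D => diagPoly hA d) d = diagPoly hA (expansion d) :=
  (map_digitSum (semiconj_diagPoly hA) d).symm

theorem isSelfAffineSet_iff_isAttractor {D : Finset (polyLattice A)} {F : Set (RepSpace hA)} :
    IsSelfAffineSet hA D F ↔ IsAttractor (repEquiv hA) (fun d : D => diagPoly hA d) F := by
  have hunion : (⋃ d ∈ D, (fun p => p + diag hA (inclLaurent hA d)) '' F) =
      ⋃ d : D, (fun p => p + diagPoly hA d) '' F := by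
    rw [← Finset.set_biUnion_coe, Set.biUnion_eq_iUnion]
    rfl
  rw [IsSelfAffineSet, hunion]
  exact ⟨fun ⟨h₁, h₂, h₃⟩ => ⟨h₁, h₂, h₃⟩, fun ⟨h₁, h₂, h₃⟩ => ⟨h₁, h₂, h₃⟩⟩

theorem map_repEquiv_range_diagPoly :
    (diagPoly hA).range.map (repEquiv hA : RepSpace hA →+ RepSpace hA) =
      (mulPoly A).range.map (diagPoly hA) := by
  have hcomp : (repEquiv hA : RepSpace hA →+ RepSpace hA).comp (diagPoly hA) =
      (diagPoly hA).comp (mulPoly A) :=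
    AddMonoidHom.ext fun x => (semiconj_diagPoly hA x).symm
  rw [AddMonoidHom.map_range, AddMonoidHom.map_range, hcomp]

theorem map_repEquiv_range_diagPoly_le :
    (diagPoly hA).range.map (repEquiv hA : RepSpace hA →+ RepSpace hA) ≤ (diagPoly hA).range := by
  rw [map_repEquiv_range_diagPoly]
  exact AddSubgroup.map_le_range _ _

theorem relIndex_map_repEquiv_range_diagPoly :
    ((diagPoly hA).range.map (repEquiv hA : RepSpace hA →+ RepSpace hA)).relIndex
      (diagPoly hA).range = residueCard A := by
  rw [map_repEquiv_range_diagPoly, AddMonoidHom.range_eq_map (diagPoly hA),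
    AddSubgroup.relIndex_map_map_of_injective _ _ (diagPoly_injective hA),
    AddSubgroup.relIndex_top_right, AddSubgroup.index_eq_card, residueCard]

theorem norm_coe_le_one_iff {y : Laurent hA} :
    ‖(y : BadicSeries hA)‖ ≤ 1 ↔ Laurent.vec hA y ∈ polyLattice A⁻¹ := by
  rw [UniformSpace.Completion.norm_coe, ← filt_zero]
  refine ⟨fun h => mem_filt_zero_of_norm_lt hA (h.trans_lt one_lt_two), fun h => ?_⟩
  exact (badicAbs_le hA h).trans_eq (by rw [neg_zero, zpow_zero])

theorem exists_eq_zero_of_norm_diagPoly_lt :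
    ∃ r > 0, ∀ x : polyLattice A, ‖diagPoly hA x‖ < r → x = 0 := by
  obtain ⟨m, hm, hint⟩ := exists_nsmul_mem_intLattice_of_mem_polyLattice_inf hA.isUnit_det
  have hm1 : (1 : ℝ) ≤ m := mod_cast Nat.one_le_iff_ne_zero.2 hm
  have hm0 : (0 : ℝ) < m := one_pos.trans_le hm1
  refine ⟨(m : ℝ)⁻¹, inv_pos.2 hm0, fun x hx => ?_⟩
  have hinv : x.1 ∈ polyLattice A⁻¹ := (norm_coe_le_one_iff hA).1
    ((norm_snd_le _).trans (hx.le.trans (inv_le_one_of_one_le₀ hm1)))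
  refine Subtype.ext (funext fun i => ?_)
  obtain ⟨z, hz⟩ := hint x.1 ⟨x.2, hinv⟩ i
  have hzi : (z : ℝ) = m * (x.1 i : ℝ) := by
    rw [Pi.smul_apply, nsmul_eq_mul] at hz
    exact mod_cast hz.symm
  have hxi : |(x.1 i : ℝ)| < (m : ℝ)⁻¹ :=
    ((PiLp.norm_apply_le (diagPoly hA x).1 i).trans (norm_fst_le _)).trans_lt hx
  have hz1 : |(z : ℝ)| < 1 := by
    rw [hzi, abs_mul, abs_of_pos hm0]
    exact (lt_inv_mul_iff₀ hm0).1 (by rwa [mul_one])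
  have hz0 : z = 0 := Int.abs_lt_one_iff.1 (mod_cast hz1)
  rw [hz0, Int.cast_zero, zero_eq_mul] at hzi
  exact mod_cast hzi.resolve_left hm0.ne'

theorem laurentLattice_le_sup {M : Matrix (Fin n) (Fin n) ℚ} (hM : IsUnit M.det) :
    laurentLattice M ≤ polyLattice M ⊔ polyLattice M⁻¹ := by
  refine iSup_le fun k => ?_
  obtain ⟨k, rfl | rfl⟩ := k.eq_nat_or_neg
  · rw [zpow_natCast]
    exact le_sup_of_le_left (le_iSup (fun k : ℕ => (intLattice n).map (act (M ^ k))) k)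
  · rw [← Matrix.inv_zpow' hM, zpow_natCast]
    exact le_sup_of_le_right (le_iSup (fun k : ℕ => (intLattice n).map (act (M⁻¹ ^ k))) k)

theorem exists_sub_diagPoly_mem (p : RepSpace hA) :
    ∃ x : polyLattice A, (∀ i, p.1 i - (diagPoly hA x).1 i ∈ Set.Icc 0 1) ∧
      p.2 - (diagPoly hA x).2 ∈ closedBall 0 1 + closedBall (0 : BadicSeries hA) 1 := by
  obtain ⟨y, hy⟩ := (UniformSpace.Completion.denseRange_coe (α := Laurent hA)).exists_dist_lt p.2
    one_pos
  obtain ⟨u, hu, v, hv, huv⟩ := AddSubgroup.mem_sup.1 (laurentLattice_le_sup hA.isUnit_det y.2)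
  let w : Fin n → ℚ := intCastVec n fun i => ⌊p.1 i - u i⌋
  have hw : w ∈ intLattice n := mem_intLattice_iff.2 ⟨_, rfl⟩
  let x : polyLattice A := ⟨u + w, add_mem hu (intLattice_le_polyLattice A hw)⟩
  refine ⟨x, fun i => ?_, p.2 - y, ?_, (y - inclLaurent hA x : Laurent hA), ?_, ?_⟩
  · have hcoord : p.1 i - (diagPoly hA x).1 i = Int.fract (p.1 i - u i) := by
      change p.1 i - ((u i + (⌊p.1 i - u i⌋ : ℤ) : ℚ) : ℝ) = _
      rw [Int.fract]
      push_cast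
      ring
    rw [hcoord]
    exact ⟨Int.fract_nonneg _, (Int.fract_lt_one _).le⟩
  · exact mem_closedBall_zero_iff.2 (dist_eq_norm p.2 _ ▸ hy.le)
  · have hvec : Laurent.vec hA (y - inclLaurent hA x) = v - w := by
      change y.1 - (u + w) = v - w
      rw [← huv, add_sub_add_left_eq_sub]
    rw [mem_closedBall_zero_iff, norm_coe_le_one_iff, hvec]
    exact sub_mem hv (intLattice_le_polyLattice A⁻¹ hw)
  · rw [UniformSpace.Completion.coe_sub]
    exact sub_add_sub_cancel _ _ _

theorem isUniformLattice_range_diagPoly : IsUniformLattice (diagPoly hA).range where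
  isUniformlyDiscrete := by
    obtain ⟨r, hr, hzero⟩ := exists_eq_zero_of_norm_diagPoly_lt hA
    refine ⟨r / 2, half_pos hr, ?_⟩
    rintro c _ ⟨hx, x, rfl⟩ _ ⟨hy, y, rfl⟩
    refine congrArg _ (sub_eq_zero.1 (hzero (x - y) ?_))
    rw [map_sub, ← dist_eq_norm, ← add_halves r]
    exact (dist_triangle_right _ _ c).trans_lt (add_lt_add hx hy)
  exists_isCompact := by
    let e := EuclideanSpace.equiv (Fin n) ℝ
    have hcube : IsCompact (e ⁻¹' Set.univ.pi fun _ => Set.Icc 0 1) :=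
      e.toHomeomorph.isCompact_preimage.2
        (isCompact_univ_pi fun _ => isCompact_Icc)
    refine ⟨_, hcube.prod ((isCompact_unitBall hA).add (isCompact_unitBall hA)), fun p => ?_⟩
    obtain ⟨x, hx, hx'⟩ := exists_sub_diagPoly_mem hA p
    exact ⟨_, neg_mem ⟨x, rfl⟩, sub_eq_add_neg p _ ▸ ⟨fun i _ => hx i, hx'⟩⟩

variable {hA} {D : Finset (polyLattice A)}

theorem IsDigitSystem.nonempty (hD : IsDigitSystem A D) : Nonempty D :=
  (Finset.card_pos.1 (hD.2 ▸ residueCard_pos hD.1.isUnit_det)).to_subtype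

theorem IsDigitSystem.existsUnique_isSelfAffineSet (hD : IsDigitSystem A D) :
    ∃! F, IsSelfAffineSet hD.1 D F := by
  have := hD.nonempty
  simp only [isSelfAffineSet_iff_isAttractor]
  exact existsUnique_isAttractor (isEventuallyContracting_repEquiv_symm hD.1)

theorem injective_digitSum_diagPoly_iff {k : ℕ} :
    Function.Injective (digitSum (repEquiv hA) (fun d : D => diagPoly hA d) :
      (Fin k → D) → RepSpace hA) ↔ Function.Injective fun d : Fin k → D => expansion d := by
  rw [funext (digitSum_diagPoly hA)]
  exact (diagPoly_injective hA).of_comp_iff _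

theorem IsDigitSystem.repMeasure_pos_iff (hD : IsDigitSystem A D) {F : Set (RepSpace hD.1)}
    (hF : IsSelfAffineSet hD.1 D F) : 0 < repMeasure hD.1 F ↔
      ∀ k, Function.Injective fun d : Fin k → D => expansion d := by
  have := hD.nonempty
  have : Countable (diagPoly hD.1).range := (Set.countable_range (diagPoly hD.1)).to_subtype
  have hindex := (relIndex_map_repEquiv_range_diagPoly hD.1).trans
    (hD.2.symm.trans (Fintype.card_coe D).symm)
  rw [((isSelfAffineSet_iff_isAttractor hD.1).1 hF).measure_pos_iff
    (isEventuallyContracting_repEquiv_symm hD.1) (isUniformLattice_range_diagPoly hD.1)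
    (map_repEquiv_range_diagPoly_le hD.1) hindex fun d => ⟨d, rfl⟩]
  exact forall_congr' fun k => injective_digitSum_diagPoly_iff

end RepSpace

end RationalTile

end

theorem mainTheorem2_general {n : ℕ} {A : Matrix (Fin n) (Fin n) ℚ}
    (D : Finset (RationalTile.polyLattice A)) (hD : RationalTile.IsDigitSystem A D) :
    (∃! F : Set (RationalTile.RepSpace hD.1), RationalTile.IsSelfAffineSet hD.1 D F) ∧
      RationalTile.IsUniformlyDiscrete
        (Set.range fun x => RationalTile.diag hD.1 (RationalTile.inclLaurent hD.1 x)) ∧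
      ∀ F : Set (RationalTile.RepSpace hD.1), RationalTile.IsSelfAffineSet hD.1 D F →
        (0 < RationalTile.repMeasure hD.1 F ↔
          ∀ k : ℕ, 1 ≤ k →
            Function.Injective fun d : Fin k → D => RationalTile.expansion d) := by
  refine ⟨hD.existsUnique_isSelfAffineSet,
    (RationalTile.isUniformLattice_range_diagPoly hD.1).isUniformlyDiscrete, fun F hF => ?_⟩
  rw [hD.repMeasure_pos_iff hF]
  refine forall_congr' fun k => ⟨fun h _ => h, fun h => ?_⟩
  rcases k.eq_zero_or_pos with rfl | hk
  · exact Function.injective_of_subsingleton _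
  · exact h hk

theorem mainTheorem2 {n : ℕ} {A : Matrix (Fin n) (Fin n) ℚ}
    (D : Finset (RationalTile.polyLattice A)) (hD : RationalTile.IsDigitSystem A D) :
    (∃! F : Set (RationalTile.RepSpace hD.1), RationalTile.IsSelfAffineSet hD.1 D F) ∧
      ∀ F : Set (RationalTile.RepSpace hD.1), RationalTile.IsSelfAffineSet hD.1 D F →
        (0 < RationalTile.repMeasure hD.1 F ↔
          (∀ k : ℕ, 1 ≤ k →
            Function.Injective fun d : Fin k → D => RationalTile.expansion d) ∧
          RationalTile.IsUniformlyDiscrete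
            ((fun x => RationalTile.diag hD.1 (RationalTile.inclLaurent hD.1 x)) ''
              RationalTile.digitBlocksInf D)) := by
  obtain ⟨hunique, hdiscrete, hpos⟩ := mainTheorem2_general D hD
  exact ⟨hunique, fun F hF => (hpos F hF).trans
    (and_iff_left (hdiscrete.mono (Set.image_subset_range _ _))).symm⟩
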